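/- Conventions. A Riesz space is a real vector lattice. For a Riesz space $E$, $E^\sim$ is its order dual (the Riesz space of order bounded linear functionals, ordered by $f\le g$ iff $f(x)\le g(x)$ for all $x\ge 0$), $E^{\sim\sim}=(E^\sim)^\sim$, $(E^\sim)_n^\sim\subseteq E^{\sim\sim}$ is the space of order continuous elements of $E^{\sim\sim}$, and $J_E\colon E\to E^{\sim\sim}$ is the canonical operator $J_E(x)(x')=x'(x)$. The weak absolute topology $|\sigma|$ on $E^{\sim\sim}$ is the locally convex topology generated by the seminorms $x''\mapsto |x''|(|x'|)$, $x'\in E^\sim$. A multilinear operator between Riesz spaces is regular if it is a difference of two positive multilinear operators. For a regular $m$-linear operator $A\colon E_1\times\cdots\times E_m\to F$, a permutation $\rho$ of $\{1,\dots,m\}$ and $x_k''\in E_k^{\sim\sim}$, the Arens extension $AR_m^\rho(A)(x_1'',\dots,x_m'')\in F^{\sim\sim}$ is defined by $$AR_m^\rho(A)(x_1'',\dots,x_m'')(y')=\big(\overline{x_{\rho(m)}''}^{\rho}\circ\cdots\circ\overline{x_{\rho(1)}''}^{\rho}\big)(y'\circ A),\qquad y'\in F^\sim,$$ where $\overline{x_{\rho(k)}''}^{\rho}$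 sends a regular multilinear form $B$ in the variables $x_j$, $j\notin\{\rho(1),\dots,\rho(k-1)\}$, to the regular multilinear form in the variables $x_j$, $j\notin\{\rho(1),\dots,\rho(k)\}$, whose value is $x_{\rho(k)}''$ applied to the functional on $E_{\rho(k)}$ obtained from $B$ by fixing all these variables (a form in no variables being a real number). Proposition. Let $E_1,\dots,E_m,F$ be Riesz spaces with $E_1,\dots,E_m$ Archimedean, let $\rho$ be a permutation of $\{1,\dots,m\}$, let $A\colon E_1\times\cdots\times E_m\to F$ be a regular $m$-linear operator, and let $x_k''\in(E_k^\sim)_n^\sim$ for $k=1,\dots,m$. Then: (1) For every $k$ there is a net $(x_{\alpha_k})_{\alpha_k}$ in $E_k$ such that $J_{E_k}(x_{\alpha_k})\to x_k''$ in the topology $|\sigma|$. (2) For all nets $(x_{\alpha_k})_{\alpha_k}$ in $E_k$ with $J_{E_k}(x_{\alpha_k})\xrightarrow{|\sigma|}x_k''$, $k=1,\dots,m$, all the limits below exist in $F^{\sim\sim}$ and $$AR_m^\rho(A)(x_1'',\dots,x_m'')=|\sigma|\text{-}\lim_{\alpha_{\rho(1)}}\cdots|\sigma|\text{-}\lim_{\alpha_{\rho(m)}}J_F(A(x_{\alpha_1},\dots,x_{\alpha_m})),$$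 and also $$AR_m^\rho(A)(x_1'',\dots,x_m'')=|\sigma|\text{-}\lim_{\alpha_{\rho(m)}}\cdots|\sigma|\text{-}\lim_{\alpha_{\rho(1)}}J_F(A(x_{\alpha_1},\dots,x_{\alpha_m})),$$ where in both formulas the rightmost limit is taken first. -/

import Mathlib

open Filter Topology

set_option linter.unusedSectionVars false

universe u v w

/-! ### Riesz spaces

A Riesz space is an ordered real vector space that is a lattice, that is, a type `E` with
`[AddCommGroup E] [Lattice E] [IsOrderedAddMonoid E] [Module ℝ E] [IsOrderedModule ℝ E]`. -/

/-- A Riesz space is Archimedean if `inf {x / n : n = 1, 2, …} = 0` for every `x ≥ 0`. -/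
def IsArchimedeanRiesz (E : Type u) [AddCommGroup E] [Lattice E] [Module ℝ E] : Prop :=
  ∀ x : E, 0 ≤ x → IsGLB (Set.range fun n : ℕ => (1 / ((n : ℝ) + 1)) • x) 0

section RieszDual

variable (E : Type u) [AddCommGroup E] [Lattice E] [IsOrderedAddMonoid E] [Module ℝ E]
  [IsOrderedModule ℝ E]

/-- The linear functionals that are bounded on every order interval. -/
def orderBoundedFunctionals : Submodule ℝ (E →ₗ[ℝ] ℝ) where
  carrier := {f | ∀ a b : E, ∃ M : ℝ, ∀ x ∈ Set.Icc a b, |f x| ≤ M}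
  zero_mem' := fun _ _ => ⟨0, fun x _ => by simp⟩
  add_mem' := by
    intro _ _ hf hg a b
    obtain ⟨M, hM⟩ := hf a b
    obtain ⟨N, hN⟩ := hg a b
    exact ⟨M + N, fun x hx => (abs_add_le _ _).trans (add_le_add (hM x hx) (hN x hx))⟩
  smul_mem' := by
    intro c f hf a b
    obtain ⟨M, hM⟩ := hf a b
    refine ⟨|c| * M, fun x hx => ?_⟩
    rw [LinearMap.smul_apply, smul_eq_mul, abs_mul]
    exact mul_le_mul_of_nonneg_left (hM x hx) (abs_nonneg c)

/-- The order dual `E^~` of a Riesz space. -/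
def RieszDual : Type u := ↥(orderBoundedFunctionals E)

namespace RieszDual

instance : AddCommGroup (RieszDual E) := inferInstanceAs (AddCommGroup ↥(orderBoundedFunctionals E))

instance : Module ℝ (RieszDual E) := inferInstanceAs (Module ℝ ↥(orderBoundedFunctionals E))

instance : FunLike (RieszDual E) E ℝ where
  coe f := f.1
  coe_injective _ _ h := Subtype.ext (DFunLike.coe_injective h)

variable {E}

/-- The element of the order dual given by an order bounded linear functional. -/
def mk (f : E →ₗ[ℝ] ℝ) (hf : f ∈ orderBoundedFunctionals E) : RieszDual E := ⟨f, hf⟩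

theorem mk_apply (f : E →ₗ[ℝ] ℝ) (hf : f ∈ orderBoundedFunctionals E) (x : E) :
    mk f hf x = f x := rfl

theorem add_apply (f g : RieszDual E) (x : E) : (f + g) x = f x + g x := rfl

theorem neg_apply (f : RieszDual E) (x : E) : (-f) x = -f x := rfl

theorem sub_apply (f g : RieszDual E) (x : E) : (f - g) x = f x - g x := rfl

theorem smul_apply (c : ℝ) (f : RieszDual E) (x : E) : (c • f) x = c * f x := rfl

theorem zero_apply (x : E) : (0 : RieszDual E) x = 0 := rfl

theorem map_add (f : RieszDual E) (x y : E) : f (x + y) = f x + f y := f.1.map_add x y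

theorem map_sub (f : RieszDual E) (x y : E) : f (x - y) = f x - f y := f.1.map_sub x y

theorem map_neg (f : RieszDual E) (x : E) : f (-x) = -f x := f.1.map_neg x

theorem map_zero (f : RieszDual E) : f 0 = 0 := f.1.map_zero

theorem map_smul (f : RieszDual E) (c : ℝ) (x : E) : f (c • x) = c * f x := f.1.map_smul c x

theorem ext_of_nonneg {f g : RieszDual E} (h : ∀ x, 0 ≤ x → f x = g x) : f = g := by
  refine DFunLike.ext _ _ fun x => ?_
  rw [← posPart_sub_negPart x, map_sub, map_sub, h _ (posPart_nonneg x), h _ (negPart_nonneg x)]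

/-- The order of the order dual: `f ≤ g` if and only if `f x ≤ g x` for all `x ≥ 0`. -/
instance : PartialOrder (RieszDual E) where
  le f g := ∀ x : E, 0 ≤ x → f x ≤ g x
  le_refl f x _ := le_rfl
  le_trans f g h hfg hgh x hx := (hfg x hx).trans (hgh x hx)
  le_antisymm f g hfg hgf := ext_of_nonneg fun x hx => le_antisymm (hfg x hx) (hgf x hx)

theorem le_def {f g : RieszDual E} : f ≤ g ↔ ∀ x : E, 0 ≤ x → f x ≤ g x := Iff.rfl

theorem mono_of_nonneg {f : RieszDual E} (hf : 0 ≤ f) {x y : E} (h : x ≤ y) : f x ≤ f y := by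
  have := hf (y - x) (sub_nonneg.2 h)
  have h0 : (0 : RieszDual E) (y - x) = 0 := rfl
  rw [h0, map_sub] at this
  linarith

instance : IsOrderedAddMonoid (RieszDual E) where
  add_le_add_left f g h k x hx := by
    have := h x hx
    rw [add_apply, add_apply]
    linarith

/-- A function that is additive and positively homogeneous on the positive cone
extends to a linear functional. -/
noncomputable def coneExtension (p : E → ℝ) (hadd : ∀ x y, 0 ≤ x → 0 ≤ y → p (x + y) = p x + p y)
    (hsmul : ∀ (c : ℝ) (x : E), 0 ≤ c → 0 ≤ x → p (c • x) = c * p x) : E →ₗ[ℝ] ℝ :=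
  have key : ∀ a b : E, 0 ≤ a → 0 ≤ b → p (a - b)⁺ - p (a - b)⁻ = p a - p b := by
    intro a b ha hb
    have h1 : (a - b)⁺ + b = a + (a - b)⁻ := by
      have := posPart_sub_negPart (a - b)
      rw [sub_eq_sub_iff_add_eq_add] at this
      exact this
    have h2 := hadd _ _ (posPart_nonneg (a - b)) hb
    have h3 := hadd _ _ ha (negPart_nonneg (a - b))
    rw [h1] at h2
    linarith
  { toFun := fun x => p x⁺ - p x⁻
    map_add' := by
      intro x y
      have h := key (x⁺ + y⁺) (x⁻ + y⁻) (add_nonneg (posPart_nonneg x) (posPart_nonneg y))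
        (add_nonneg (negPart_nonneg x) (negPart_nonneg y))
      rw [add_sub_add_comm, posPart_sub_negPart, posPart_sub_negPart,
        hadd _ _ (posPart_nonneg x) (posPart_nonneg y),
        hadd _ _ (negPart_nonneg x) (negPart_nonneg y)] at h
      rw [h]
      ring
    map_smul' := by
      intro c x
      rw [RingHom.id_apply, smul_eq_mul]
      rcases le_total 0 c with hc | hc
      · have h := key (c • x⁺) (c • x⁻) (smul_nonneg hc (posPart_nonneg x))
          (smul_nonneg hc (negPart_nonneg x))
        rw [← smul_sub, posPart_sub_negPart, hsmul _ _ hc (posPart_nonneg x),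
          hsmul _ _ hc (negPart_nonneg x)] at h
        rw [h]
        ring
      · have hc' : 0 ≤ -c := neg_nonneg.2 hc
        have h := key ((-c) • x⁻) ((-c) • x⁺) (smul_nonneg hc' (negPart_nonneg x))
          (smul_nonneg hc' (posPart_nonneg x))
        rw [← smul_sub, ← neg_sub (x⁺) (x⁻), posPart_sub_negPart, smul_neg, neg_smul, neg_neg,
          hsmul _ _ hc' (posPart_nonneg x), hsmul _ _ hc' (negPart_nonneg x)] at h
        rw [h]
        ring }

theorem coneExtension_apply_of_nonneg (p : E → ℝ)
    (hadd : ∀ x y, 0 ≤ x → 0 ≤ y → p (x + y) = p x + p y)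
    (hsmul : ∀ (c : ℝ) (x : E), 0 ≤ c → 0 ≤ x → p (c • x) = c * p x) {x : E} (hx : 0 ≤ x) :
    coneExtension p hadd hsmul x = p x := by
  have h0 : p 0 = 0 := by simpa using hsmul 0 0 le_rfl le_rfl
  change p x⁺ - p x⁻ = p x
  rw [posPart_eq_self.2 hx, negPart_eq_zero.2 hx, h0, sub_zero]

/-- A positive linear functional is order bounded. -/
theorem mem_of_nonneg (f : E →ₗ[ℝ] ℝ) (hf : ∀ x, 0 ≤ x → 0 ≤ f x) :
    f ∈ orderBoundedFunctionals E := by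
  intro a b
  refine ⟨|f a| + |f b|, fun x hx => ?_⟩
  have h1 := hf _ (sub_nonneg.2 hx.1)
  have h2 := hf _ (sub_nonneg.2 hx.2)
  rw [_root_.map_sub] at h1 h2
  rw [abs_le]
  constructor <;>
    linarith [neg_abs_le (f a), le_abs_self (f b), abs_nonneg (f a), abs_nonneg (f b)]

/-- The value at `x ≥ 0` of the positive part of an order bounded functional:
`sup {f y : 0 ≤ y ≤ x}`. -/
noncomputable def posValue (f : RieszDual E) (x : E) : ℝ := sSup (f '' Set.Icc 0 x)

theorem isLUB_posValue (f : RieszDual E) {x : E} (hx : 0 ≤ x) :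
    IsLUB (f '' Set.Icc 0 x) (posValue f x) := by
  refine isLUB_csSup ⟨f 0, Set.mem_image_of_mem _ ⟨le_rfl, hx⟩⟩ ?_
  obtain ⟨M, hM⟩ := f.2 0 x
  refine ⟨M, ?_⟩
  rintro _ ⟨y, hy, rfl⟩
  exact (le_abs_self _).trans (hM y hy)

theorem le_posValue (f : RieszDual E) {x y : E} (hy : 0 ≤ y) (hyx : y ≤ x) :
    f y ≤ posValue f x :=
  (isLUB_posValue f (hy.trans hyx)).1 (Set.mem_image_of_mem _ ⟨hy, hyx⟩)

theorem posValue_le (f : RieszDual E) {x : E} (hx : 0 ≤ x) {r : ℝ}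
    (h : ∀ y, 0 ≤ y → y ≤ x → f y ≤ r) : posValue f x ≤ r := by
  refine (isLUB_posValue f hx).2 ?_
  rintro _ ⟨y, hy, rfl⟩
  exact h y hy.1 hy.2

theorem posValue_add (f : RieszDual E) (x y : E) (hx : 0 ≤ x) (hy : 0 ≤ y) :
    posValue f (x + y) = posValue f x + posValue f y := by
  refine le_antisymm ?_ ?_
  · refine posValue_le f (add_nonneg hx hy) fun z hz hzxy => ?_
    have h1 : z - z ⊓ x ≤ y := by
      rw [sub_le_iff_le_add, ← sub_le_iff_le_add']
      refine le_inf ?_ ?_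
      · exact sub_le_self _ hy
      · rwa [sub_le_iff_le_add]
    have h2 : f z = f (z ⊓ x) + f (z - z ⊓ x) := by rw [map_sub]; ring
    rw [h2]
    exact add_le_add (le_posValue f (le_inf hz hx) inf_le_right)
      (le_posValue f (sub_nonneg.2 inf_le_left) h1)
  · rw [← le_sub_iff_add_le]
    refine posValue_le f hx fun a ha hax => ?_
    rw [le_sub_comm]
    refine posValue_le f hy fun b hb hby => ?_
    have := le_posValue f (add_nonneg ha hb) (add_le_add hax hby)
    rw [map_add] at this
    linarith

theorem posValue_smul (f : RieszDual E) (c : ℝ) (x : E) (hc : 0 ≤ c) (hx : 0 ≤ x) :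
    posValue f (c • x) = c * posValue f x := by
  have hle : ∀ (c : ℝ) (x : E), 0 ≤ c → 0 ≤ x → c * posValue f x ≤ posValue f (c • x) := by
    intro c x hc hx
    rcases hc.eq_or_lt with rfl | hc'
    · have h := le_posValue f (x := (0 : ℝ) • x) le_rfl (by rw [zero_smul])
      rw [map_zero] at h
      rwa [zero_mul]
    · rw [mul_comm, ← le_div_iff₀ hc']
      refine posValue_le f hx fun y hy hyx => ?_
      rw [le_div_iff₀ hc', mul_comm, ← map_smul]
      exact le_posValue f (smul_nonneg hc hy) (smul_le_smul_of_nonneg_left hyx hc)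
  refine le_antisymm ?_ (hle c x hc hx)
  rcases hc.eq_or_lt with rfl | hc'
  · rw [zero_smul, zero_mul]
    refine posValue_le f le_rfl fun y hy hy0 => ?_
    rw [le_antisymm hy0 hy, map_zero]
  · have h := hle c⁻¹ (c • x) (inv_nonneg.2 hc) (smul_nonneg hc hx)
    rw [smul_smul, inv_mul_cancel₀ hc'.ne', one_smul, inv_mul_le_iff₀ hc'] at h
    exact h

/-- The positive part of an order bounded functional, given by the Riesz–Kantorovich formula. -/
noncomputable def pos (f : RieszDual E) : RieszDual E :=
  mk (coneExtension (posValue f) (posValue_add f) (posValue_smul f))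
    (mem_of_nonneg _ fun x hx => by
      rw [coneExtension_apply_of_nonneg _ _ _ hx, ← map_zero f]
      exact le_posValue f le_rfl hx)

theorem pos_apply (f : RieszDual E) {x : E} (hx : 0 ≤ x) : pos f x = posValue f x :=
  coneExtension_apply_of_nonneg _ (posValue_add f) (posValue_smul f) hx

theorem le_pos (f : RieszDual E) : f ≤ pos f := fun x hx => by
  rw [pos_apply f hx]; exact le_posValue f hx le_rfl

theorem pos_nonneg (f : RieszDual E) : 0 ≤ pos f := fun x hx => by
  rw [pos_apply f hx, zero_apply, ← map_zero f]
  exact le_posValue f le_rfl hx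

theorem pos_le {f g : RieszDual E} (hfg : f ≤ g) (hg : 0 ≤ g) : pos f ≤ g := fun x hx => by
  rw [pos_apply f hx]
  exact posValue_le f hx fun y hy hyx => (hfg y hy).trans (mono_of_nonneg hg hyx)

/-- The order dual is a lattice: `f ⊔ g = (f - g)⁺ + g` and `f ⊓ g = f - (f - g)⁺`. -/
noncomputable instance : Lattice (RieszDual E) where
  sup f g := pos (f - g) + g
  inf f g := f - pos (f - g)
  le_sup_left f g := by
    rw [← sub_le_iff_le_add]
    exact le_pos _
  le_sup_right f g := le_add_of_nonneg_left (pos_nonneg _)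
  sup_le f g h hf hg := by
    rw [← le_sub_iff_add_le]
    exact pos_le (sub_le_sub_right hf g) (sub_nonneg.2 hg)
  inf_le_left f g := sub_le_self _ (pos_nonneg _)
  inf_le_right f g := by
    rw [sub_le_comm]
    exact le_pos _
  le_inf h f g hf hg := by
    rw [le_sub_comm]
    exact pos_le (sub_le_sub_left hg _) (sub_nonneg.2 hf)

instance : IsOrderedModule ℝ (RieszDual E) where
  smul_le_smul_of_nonneg_left c hc f g hfg x hx := by
    rw [smul_apply, smul_apply]
    exact mul_le_mul_of_nonneg_left (hfg x hx) hc
  smul_le_smul_of_nonneg_right f hf c d hcd x hx := by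
    rw [smul_apply, smul_apply]
    exact mul_le_mul_of_nonneg_right hcd (hf x hx)

theorem abs_apply_le {f : RieszDual E} {x y : E} (h : |x| ≤ y) : |f x| ≤ |f| y := by
  have key : ∀ z : E, 0 ≤ z → |f z| ≤ |f| z := fun z hz => by
    have h1 := (le_abs_self f) z hz
    have h2 := (neg_le_abs f) z hz
    rw [neg_apply] at h2
    exact abs_le.2 ⟨by linarith, h1⟩
  have h1 := key _ (posPart_nonneg x)
  have h2 := key _ (negPart_nonneg x)
  have h3 : |f| |x| ≤ |f| y := mono_of_nonneg (abs_nonneg f) h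
  rw [← posPart_add_negPart x, map_add] at h3
  have h4 : f x = f x⁺ - f x⁻ := by rw [← map_sub, posPart_sub_negPart]
  rw [h4]
  exact (abs_sub _ _).trans (by linarith)

theorem abs_smul_eq (c : ℝ) (f : RieszDual E) : |c • f| = |c| • |f| := by
  have hle : ∀ (c : ℝ) (f : RieszDual E), |c • f| ≤ |c| • |f| := by
    intro c f
    rw [abs_le']
    refine ⟨fun x hx => ?_, fun x hx => ?_⟩
    all_goals
      have h := abs_apply_le (f := f) (abs_of_nonneg hx).le
      have h' := mul_le_mul_of_nonneg_left h (abs_nonneg c)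
      rw [← abs_mul] at h'
      have h1 := le_abs_self (c * f x)
      have h2 := neg_le_abs (c * f x)
      simp only [neg_apply, smul_apply]
      linarith
  refine le_antisymm (hle c f) ?_
  rcases eq_or_ne c 0 with rfl | hc
  · simp
  · have h := hle c⁻¹ (c • f)
    rw [smul_smul, inv_mul_cancel₀ hc, one_smul] at h
    have h' := smul_le_smul_of_nonneg_left h (abs_nonneg c)
    rwa [smul_smul, ← abs_mul, mul_inv_cancel₀ hc, abs_one, one_smul] at h'

/-- The seminorm `f ↦ |f|(|x|)` on the order dual. -/
noncomputable def absSeminorm (x : E) : Seminorm ℝ (RieszDual E) :=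
  Seminorm.of (fun f => |f| |x|)
    (fun f g => by
      have := (abs_add_le f g) |x| (abs_nonneg x)
      rwa [add_apply] at this)
    (fun c f => by
      change |c • f| |x| = |c| * |f| |x|
      rw [abs_smul_eq, smul_apply])

theorem absSeminorm_apply (x : E) (f : RieszDual E) : absSeminorm x f = |f| |x| := rfl

variable (E) in
/-- The family of seminorms `f ↦ |f|(|x|)`, `x ∈ E`, on the order dual of `E`. -/
noncomputable def absSeminormFamily : SeminormFamily ℝ (RieszDual E) E := fun x => absSeminorm x

/-- The weak absolute topology `|σ|(E^~, E)`: the locally convex topology on the order dual that is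
generated by the seminorms `f ↦ |f|(|x|)`, `x ∈ E`. -/
noncomputable instance : TopologicalSpace (RieszDual E) := (absSeminormFamily E).moduleFilterBasis.topology

theorem withSeminorms : WithSeminorms (absSeminormFamily E) := ⟨rfl⟩

end RieszDual

/-- The second order dual `E^~~`. -/
abbrev RieszBidual : Type u := RieszDual (RieszDual E)

variable {E}

/-- The canonical operator `J_E : E → E^~~`, `J_E(x)(x') = x'(x)`. -/
noncomputable def canonicalJ (x : E) : RieszBidual E :=
  RieszDual.mk
    { toFun := fun f => f x
      map_add' := fun _ _ => rfl
      map_smul' := fun _ _ => rfl }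
    (by
      intro a b
      refine ⟨(|a| + |b|) |x|, fun f hf => ?_⟩
      refine (RieszDual.abs_apply_le (f := f) le_rfl).trans ?_
      have h : |f| ≤ |a| + |b| := by
        rw [abs_le']
        constructor
        · exact (hf.2.trans (le_abs_self b)).trans (le_add_of_nonneg_left (abs_nonneg a))
        · exact ((neg_le_neg hf.1).trans (neg_le_abs a)).trans
            (le_add_of_nonneg_right (abs_nonneg b))
      exact h |x| (abs_nonneg x))

theorem canonicalJ_apply (x : E) (f : RieszDual E) : canonicalJ x f = f x := rfl

/-- Order continuity of an order bounded functional: `f (x i) → 0` for every net `x` that converges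
to `0` in order, that is, such that `|x i| ≤ y i` for a net `y` decreasing to `0`. For `G = E^~`
this predicate on `E^~~` describes the subspace `(E^~)_n^~`. -/
def IsOrderContinuousFunctional {G : Type u} [AddCommGroup G] [Lattice G] [IsOrderedAddMonoid G]
    [Module ℝ G] [IsOrderedModule ℝ G] (f : RieszDual G) : Prop :=
  ∀ (I : Type u) [Preorder I] [IsDirectedOrder I] [Nonempty I] (x y : I → G),
    Antitone y → IsGLB (Set.range y) 0 → (∀ i, |x i| ≤ y i) →
      Tendsto (fun i => f (x i)) atTop (𝓝 0)

end RieszDual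

/-! ### Regular multilinear operators and their Arens extensions -/

/-- A multilinear operator is positive if it takes positive vectors to positive vectors. -/
def IsPositiveMultilinear {ι : Type w} {E : ι → Type u} {F : Type v}
    [∀ i, AddCommGroup (E i)] [∀ i, Lattice (E i)] [∀ i, Module ℝ (E i)]
    [AddCommGroup F] [Lattice F] [Module ℝ F] (A : MultilinearMap ℝ E F) : Prop :=
  ∀ x : ∀ i, E i, (∀ i, 0 ≤ x i) → 0 ≤ A x

/-- A multilinear operator is regular if it is the difference of two positive ones. -/
def IsRegularMultilinear {ι : Type w} {E : ι → Type u} {F : Type v}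
    [∀ i, AddCommGroup (E i)] [∀ i, Lattice (E i)] [∀ i, Module ℝ (E i)]
    [AddCommGroup F] [Lattice F] [Module ℝ F] (A : MultilinearMap ℝ E F) : Prop :=
  ∃ A₁ A₂ : MultilinearMap ℝ E F,
    IsPositiveMultilinear A₁ ∧ IsPositiveMultilinear A₂ ∧ A = A₁ - A₂

namespace Arens

section Domination

variable {n : ℕ} {E : Fin n → Type u} [∀ i, AddCommGroup (E i)] [∀ i, Lattice (E i)]
  [∀ i, Module ℝ (E i)]

/-- `D` dominates `B`: `|B x| ≤ D x` for all positive `x`. An auxiliary notion. -/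
def Dom (D B : MultilinearMap ℝ E ℝ) : Prop :=
  ∀ x : ∀ i, E i, (∀ i, 0 ≤ x i) → |B x| ≤ D x

theorem Dom.isPositive {D B : MultilinearMap ℝ E ℝ} (h : Dom D B) : IsPositiveMultilinear D :=
  fun x hx => (abs_nonneg _).trans (h x hx)

theorem Dom.isRegular {D B : MultilinearMap ℝ E ℝ} (h : Dom D B) : IsRegularMultilinear B := by
  refine ⟨(1 / 2 : ℝ) • (D + B), (1 / 2 : ℝ) • (D - B), ?_, ?_, ?_⟩
  · intro x hx
    have := (abs_le.1 (h x hx)).1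
    simp only [_root_.smul_apply, _root_.add_apply, smul_eq_mul]
    linarith
  · intro x hx
    have := (abs_le.1 (h x hx)).2
    simp only [_root_.smul_apply, _root_.sub_apply, smul_eq_mul]
    linarith
  · ext x
    simp only [_root_.smul_apply, _root_.sub_apply, _root_.add_apply,
      smul_eq_mul]
    ring

theorem exists_dom {B : MultilinearMap ℝ E ℝ} (h : IsRegularMultilinear B) : ∃ D, Dom D B := by
  obtain ⟨A₁, A₂, h₁, h₂, rfl⟩ := h
  refine ⟨A₁ + A₂, fun x hx => ?_⟩
  have := h₁ x hx
  have := h₂ x hx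
  simp only [_root_.sub_apply, _root_.add_apply]
  rw [abs_le]
  constructor <;> linarith

end Domination

theorem Dom.abs_le : ∀ {n : ℕ} {E : Fin n → Type u} [∀ i, AddCommGroup (E i)]
    [∀ i, Lattice (E i)] [∀ i, IsOrderedAddMonoid (E i)] [∀ i, Module ℝ (E i)]
    {D B : MultilinearMap ℝ E ℝ}, Dom D B → ∀ {x y : ∀ i, E i}, (∀ i, |x i| ≤ y i) →
      |B x| ≤ D y := by
  intro n
  induction n with
  | zero =>
    intro E _ _ _ _ D B h x y _
    rw [Subsingleton.elim y x]
    exact h x fun i => i.elim0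
  | succ n ih =>
    intro E _ _ _ _ D B h x y hxy
    have hy : ∀ i, 0 ≤ y i := fun i => (abs_nonneg _).trans (hxy i)
    have hD : Dom (D.curryLeft (y 0)) (B.curryLeft (x 0)) := by
      intro t ht
      have hc : ∀ e : E 0, 0 ≤ e → |B (Fin.cons e t)| ≤ D (Fin.cons e t) := by
        intro e he
        refine h _ fun i => ?_
        refine Fin.cases ?_ (fun j => ?_) i
        · simpa using he
        · simpa using ht j
      have h1 := hc _ (posPart_nonneg (x 0))
      have h2 := hc _ (negPart_nonneg (x 0))
      have h3 : B.curryLeft (x 0) t = B.curryLeft (x 0)⁺ t - B.curryLeft (x 0)⁻ t := by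
        rw [← _root_.sub_apply, ← map_sub, posPart_sub_negPart]
      have h4 : D.curryLeft |x 0| t = D.curryLeft (x 0)⁺ t + D.curryLeft (x 0)⁻ t := by
        rw [← _root_.add_apply, ← map_add, posPart_add_negPart]
      have h5 : 0 ≤ D.curryLeft (y 0 - |x 0|) t := by
        refine h.isPositive _ fun i => ?_
        refine Fin.cases ?_ (fun j => ?_) i
        · simpa using hxy 0
        · simpa using ht j
      rw [map_sub, _root_.sub_apply] at h5
      rw [h3]
      simp only [MultilinearMap.curryLeft_apply] at *
      exact (abs_sub _ _).trans (by linarith)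
    have := ih hD (x := Fin.tail x) (y := Fin.tail y) fun i => hxy i.succ
    simpa using this

section Forms

variable {n : ℕ} (E : Fin n → Type u) [∀ i, AddCommGroup (E i)] [∀ i, Lattice (E i)]
  [∀ i, IsOrderedAddMonoid (E i)] [∀ i, Module ℝ (E i)] [∀ i, IsOrderedModule ℝ (E i)]

/-- The space of regular multilinear forms on `E 0 × ⋯ × E (n - 1)`. -/
def RegularForm : Submodule ℝ (MultilinearMap ℝ E ℝ) where
  carrier := {B | IsRegularMultilinear B}
  zero_mem' := Dom.isRegular (D := 0) fun x _ => by simp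
  add_mem' := by
    intro B C hB hC
    obtain ⟨D, hD⟩ := exists_dom hB
    obtain ⟨D', hD'⟩ := exists_dom hC
    exact Dom.isRegular (D := D + D') fun x hx =>
      (abs_add_le _ _).trans (add_le_add (hD x hx) (hD' x hx))
  smul_mem' := by
    intro c B hB
    obtain ⟨D, hD⟩ := exists_dom hB
    refine Dom.isRegular (D := |c| • D) fun x hx => ?_
    rw [_root_.smul_apply, _root_.smul_apply, smul_eq_mul, smul_eq_mul, abs_mul]
    exact mul_le_mul_of_nonneg_left (hD x hx) (abs_nonneg c)

end Forms

section Step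

variable {n : ℕ} {E : Fin (n + 1) → Type u} [∀ i, AddCommGroup (E i)] [∀ i, Lattice (E i)]
  [∀ i, IsOrderedAddMonoid (E i)] [∀ i, Module ℝ (E i)] [∀ i, IsOrderedModule ℝ (E i)]

/-- The functional `B(•, t) : e ↦ B(e, t)` associated to a regular form `B`, where the dot is placed
at the first coordinate and `t` lists the remaining ones. -/
def assoc (B : RegularForm E) (t : ∀ i : Fin n, E i.succ) : RieszDual (E 0) :=
  RieszDual.mk
    { toFun := fun e => B.1 (Fin.cons e t)
      map_add' := fun e e' => MultilinearMap.cons_add B.1 t e e'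
      map_smul' := fun c e => MultilinearMap.cons_smul B.1 t c e }
    (by
      obtain ⟨D, hD⟩ := exists_dom B.2
      intro a b
      refine ⟨D (Fin.cons (|a| + |b|) fun i => |t i|), fun e he => ?_⟩
      refine hD.abs_le fun i => ?_
      refine Fin.cases ?_ (fun j => ?_) i
      · simp only [Fin.cons_zero]
        rw [abs_le']
        constructor
        · exact (he.2.trans (le_abs_self b)).trans (le_add_of_nonneg_left (abs_nonneg a))
        · exact ((neg_le_neg he.1).trans (neg_le_abs a)).trans
            (le_add_of_nonneg_right (abs_nonneg b))
      · simp)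

theorem assoc_apply (B : RegularForm E) (t : ∀ i : Fin n, E i.succ) (e : E 0) :
    assoc B t e = B.1 (Fin.cons e t) := rfl

/-- The multilinear form `t ↦ x''(B(•, t))`. -/
noncomputable def stepForm (x'' : RieszBidual (E 0)) (B : RegularForm E) :
    MultilinearMap ℝ (fun i : Fin n => E i.succ) ℝ :=
  MultilinearMap.mk' (fun t => x'' (assoc B t))
    (fun t i a b => by
      rw [← RieszDual.map_add]
      congr 1
      refine DFunLike.ext _ _ fun e => ?_
      simp only [RieszDual.add_apply, assoc_apply, Fin.cons_update, MultilinearMap.map_update_add])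
    (fun t i c a => by
      rw [smul_eq_mul, ← RieszDual.map_smul]
      congr 1
      refine DFunLike.ext _ _ fun e => ?_
      simp only [RieszDual.smul_apply, assoc_apply, Fin.cons_update,
        MultilinearMap.map_update_smul, smul_eq_mul])

theorem stepForm_apply (x'' : RieszBidual (E 0)) (B : RegularForm E) (t : ∀ i : Fin n, E i.succ) :
    stepForm x'' B t = x'' (assoc B t) := rfl

theorem stepForm_dom (x'' : RieszBidual (E 0)) {D B : RegularForm E} (h : Dom D.1 B.1) :
    Dom (stepForm |x''| D) (stepForm x'' B) := by
  intro t ht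
  have hpos : ∀ e : E 0, 0 ≤ e → |assoc B t e| ≤ assoc D t e := by
    intro e he
    refine h _ fun i => ?_
    refine Fin.cases ?_ (fun j => ?_) i
    · simpa using he
    · simpa using ht j
  refine RieszDual.abs_apply_le ?_
  rw [_root_.abs_le']
  refine ⟨fun e he => (le_abs_self _).trans (hpos e he), fun e he => ?_⟩
  rw [RieszDual.neg_apply]
  exact (neg_le_abs _).trans (hpos e he)

/-- The operator `B ↦ (t ↦ x''(B(•, t)))` from the regular forms on `E 0 × E 1 × ⋯ × E n` to the
regular forms on `E 1 × ⋯ × E n`, for `x''` in the second order dual of `E 0`. -/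
noncomputable def step (x'' : RieszBidual (E 0)) :
    RegularForm E →ₗ[ℝ] RegularForm (fun i : Fin n => E i.succ) where
  toFun B := ⟨stepForm x'' B, by
    obtain ⟨D, hD⟩ := exists_dom B.2
    have hDr : IsRegularMultilinear D :=
      Dom.isRegular (D := D) fun x hx => (abs_of_nonneg (hD.isPositive x hx)).le
    exact (stepForm_dom x'' (D := ⟨D, hDr⟩) hD).isRegular⟩
  map_add' B C := by
    refine Subtype.ext (MultilinearMap.ext fun t => ?_)
    change x'' (assoc (B + C) t) = x'' (assoc B t) + x'' (assoc C t)
    rw [← RieszDual.map_add]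
    rfl
  map_smul' c B := by
    refine Subtype.ext (MultilinearMap.ext fun t => ?_)
    change x'' (assoc (c • B) t) = c * x'' (assoc B t)
    rw [← RieszDual.map_smul]
    rfl

theorem step_apply (x'' : RieszBidual (E 0)) (B : RegularForm E) (t : ∀ i : Fin n, E i.succ) :
    (step x'' B).1 t = x'' (assoc B t) := rfl

end Step

/-- Successive application of `x 0''`, then `x 1''`, …, then `x (n - 1)''` to a regular form, each
to the first of the remaining coordinates; the regular forms in no variables are identified with
the real numbers. -/
noncomputable def iterate : ∀ {n : ℕ} {E : Fin n → Type u} [∀ i, AddCommGroup (E i)] [∀ i, Lattice (E i)]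
    [∀ i, IsOrderedAddMonoid (E i)] [∀ i, Module ℝ (E i)] [∀ i, IsOrderedModule ℝ (E i)],
    (∀ i, RieszBidual (E i)) → RegularForm E →ₗ[ℝ] ℝ
  | 0, _, _, _, _, _, _, _ =>
    { toFun := fun B => B.1 fun i => i.elim0
      map_add' := fun _ _ => rfl
      map_smul' := fun _ _ => rfl }
  | _ + 1, _, _, _, _, _, _, x'' => (iterate fun i => x'' i.succ).comp (step (x'' 0))

theorem iterate_dom : ∀ {n : ℕ} {E : Fin n → Type u} [∀ i, AddCommGroup (E i)]
    [∀ i, Lattice (E i)] [∀ i, IsOrderedAddMonoid (E i)] [∀ i, Module ℝ (E i)]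
    [∀ i, IsOrderedModule ℝ (E i)] (x'' : ∀ i, RieszBidual (E i)) {D B : RegularForm E},
    Dom D.1 B.1 → |iterate x'' B| ≤ iterate (fun i => |x'' i|) D := by
  intro n
  induction n with
  | zero =>
    intro E _ _ _ _ _ x'' D B h
    exact h _ fun i => i.elim0
  | succ n ih =>
    intro E _ _ _ _ _ x'' D B h
    exact ih (fun i => x'' i.succ) (stepForm_dom (x'' 0) h)

section Extension

variable {m : ℕ} {E : Fin m → Type u} {F : Type v} [∀ i, AddCommGroup (E i)] [∀ i, Lattice (E i)]
  [∀ i, IsOrderedAddMonoid (E i)] [∀ i, Module ℝ (E i)] [∀ i, IsOrderedModule ℝ (E i)]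
  [AddCommGroup F] [Lattice F] [IsOrderedAddMonoid F] [Module ℝ F] [IsOrderedModule ℝ F]

/-- The tuple whose coordinate number `ρ j` is `t j`, for every `j`. -/
def unorder {X : Fin m → Type w} (ρ : Equiv.Perm (Fin m)) (t : ∀ j, X (ρ j)) : ∀ k, X k :=
  Equiv.piCongrLeft X ρ t

theorem unorder_apply {X : Fin m → Type w} (ρ : Equiv.Perm (Fin m)) (t : ∀ j, X (ρ j))
    (j : Fin m) : unorder ρ t (ρ j) = t j :=
  Equiv.piCongrLeft_apply_apply X ρ t j

theorem unorder_update {X : Fin m → Type w} (ρ : Equiv.Perm (Fin m)) (t : ∀ j, X (ρ j))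
    (j : Fin m) (c : X (ρ j)) :
    unorder ρ (Function.update t j c) = Function.update (unorder ρ t) (ρ j) c := by
  funext k
  obtain ⟨i, rfl⟩ := ρ.surjective k
  rw [unorder_apply]
  rcases eq_or_ne i j with rfl | hij
  · rw [Function.update_self, Function.update_self]
  · rw [Function.update_of_ne hij, Function.update_of_ne (ρ.injective.ne hij), unorder_apply]

theorem unorder_prop {X : Fin m → Type w} (ρ : Equiv.Perm (Fin m)) {p : ∀ k, X k → Prop}
    {t : ∀ j, X (ρ j)} (h : ∀ j, p (ρ j) (t j)) (k : Fin m) : p k (unorder ρ t k) := by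
  obtain ⟨j, rfl⟩ := ρ.surjective k
  rw [unorder_apply]
  exact h j

/-- The form `y' ∘ A` with the variables listed in the order `ρ 0, ρ 1, …, ρ (m - 1)`. -/
noncomputable def composedForm (ρ : Equiv.Perm (Fin m)) (A : MultilinearMap ℝ E F) (y' : RieszDual F) :
    MultilinearMap ℝ (fun j => E (ρ j)) ℝ :=
  MultilinearMap.mk' (fun t => y' (A (unorder ρ t)))
    (fun t j a b => by
      have hu : ∀ c, unorder ρ (Function.update t j c) = Function.update (unorder ρ t) (ρ j) c :=
        unorder_update ρ t j
      rw [hu, hu, hu, A.map_update_add, RieszDual.map_add])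
    (fun t j c a => by
      have hu : ∀ c, unorder ρ (Function.update t j c) = Function.update (unorder ρ t) (ρ j) c :=
        unorder_update ρ t j
      rw [hu, hu, A.map_update_smul, RieszDual.map_smul, smul_eq_mul])

theorem composedForm_apply (ρ : Equiv.Perm (Fin m)) (A : MultilinearMap ℝ E F) (y' : RieszDual F)
    (t : ∀ j, E (ρ j)) : composedForm ρ A y' t = y' (A (unorder ρ t)) := rfl

theorem composedForm_dom (ρ : Equiv.Perm (Fin m)) {A₁ A₂ : MultilinearMap ℝ E F}
    (h₁ : IsPositiveMultilinear A₁) (h₂ : IsPositiveMultilinear A₂) {y' z' : RieszDual F}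
    (h : |y'| ≤ z') : Dom (composedForm ρ (A₁ + A₂) z') (composedForm ρ (A₁ - A₂) y') := by
  intro t ht
  have ht' := unorder_prop ρ (p := fun k x => (0 : E k) ≤ x) ht
  have hp₁ := h₁ _ ht'
  have hp₂ := h₂ _ ht'
  simp only [composedForm_apply, _root_.sub_apply, _root_.add_apply]
  set a := A₁ (unorder ρ t)
  set b := A₂ (unorder ρ t)
  have hab : |a - b| ≤ a + b := by
    rw [abs_le', neg_sub]
    exact ⟨(sub_le_self a hp₂).trans (le_add_of_nonneg_right hp₂),
      (sub_le_self b hp₁).trans (le_add_of_nonneg_left hp₁)⟩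
  exact (RieszDual.abs_apply_le hab).trans (h _ (add_nonneg hp₁ hp₂))

theorem composedForm_regular (ρ : Equiv.Perm (Fin m)) {A : MultilinearMap ℝ E F}
    (hA : IsRegularMultilinear A) (y' : RieszDual F) :
    IsRegularMultilinear (composedForm ρ A y') := by
  obtain ⟨A₁, A₂, h₁, h₂, rfl⟩ := hA
  exact (composedForm_dom ρ h₁ h₂ (y' := y') le_rfl).isRegular

/-- The Arens extension `AR_m^ρ(A) : E_1^~~ × ⋯ × E_m^~~ → F^~~` of a regular `m`-linear operator
`A : E_1 × ⋯ × E_m → F`: the value at `y'` is obtained from the form `y' ∘ A` by applying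
first `x_{ρ(1)}''` to the coordinate `ρ(1)`, then `x_{ρ(2)}''` to the coordinate `ρ(2)`, and so on,
and finally `x_{ρ(m)}''` to the coordinate `ρ(m)`. -/
noncomputable def extension (ρ : Equiv.Perm (Fin m)) (A : MultilinearMap ℝ E F) (hA : IsRegularMultilinear A)
    (x'' : ∀ k, RieszBidual (E k)) : RieszBidual F :=
  RieszDual.mk
    { toFun := fun y' =>
        iterate (fun j => x'' (ρ j)) ⟨composedForm ρ A y', composedForm_regular ρ hA y'⟩
      map_add' := fun y' z' => by
        rw [← map_add]
        rfl
      map_smul' := fun c y' => by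
        rw [RingHom.id_apply, ← map_smul]
        rfl }
    (by
      intro a b
      obtain ⟨A₁, A₂, h₁, h₂, rfl⟩ := id hA
      have hD : IsRegularMultilinear (A₁ + A₂) :=
        ⟨A₁ + A₂, 0, fun x hx => add_nonneg (h₁ x hx) (h₂ x hx), fun x _ => le_rfl, by simp⟩
      refine ⟨iterate (fun j => |x'' (ρ j)|)
        ⟨composedForm ρ (A₁ + A₂) (|a| + |b|), composedForm_regular ρ hD _⟩, fun y' hy => ?_⟩
      refine iterate_dom _ (composedForm_dom ρ h₁ h₂ ?_)
      rw [abs_le']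
      constructor
      · exact (hy.2.trans (le_abs_self b)).trans (le_add_of_nonneg_left (abs_nonneg a))
      · exact ((neg_le_neg hy.1).trans (neg_le_abs a)).trans
          (le_add_of_nonneg_right (abs_nonneg b)))

end Extension

/-- `IsIteratedLimit u L`: the iterated limit `lim_{a 0} lim_{a 1} ⋯ lim_{a (n - 1)} u(a)` exists
and equals `L`, where `a i` runs through the directed set `I i`; the limit over `a (n - 1)`
is the innermost one (taken first) and the limit over `a 0` is the outermost one (taken last). -/
def IsIteratedLimit {G : Type v} [TopologicalSpace G] :
    ∀ {n : ℕ} {I : Fin n → Type w} [∀ i, Preorder (I i)], ((∀ i, I i) → G) → G → Prop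
  | 0, _, _, u, L => u (fun i => i.elim0) = L
  | n + 1, I, _, u, L => ∃ v : I 0 → G,
      (∀ a : I 0, IsIteratedLimit (I := fun i : Fin n => I i.succ) (fun t => u (Fin.cons a t)) (v a))
        ∧ Tendsto v atTop (𝓝 L)

end Arens

/-! For (1) the point is that J(E) is |σ|-dense in the order continuous part of E^~~. Infima of
decreasing nets of positive functionals are computed pointwise, so every J x is order continuous. If
φ and ψ are disjoint, positive and order continuous, each positive u splits into disjoint u₁ + u₂
with φ u₁ = 0 and ψ u₂ = 0 (`exists_disjoint_decomposition`). Hence a positive order continuous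
functional disjoint from J(E) vanishes, and a positive order continuous z is the limit of its
truncations z ⊓ J d (`tendsto_posPart_sub_canonicalJ`). If |z| ≤ J(2e), splitting u along z⁺ and z⁻
produces x with |z - J x| below J e, up to a small error at u; repeated halving gives
`exists_canonicalJ_near`.

For (2), density and truncation show that order continuous functionals on two factors may be applied
to a regular bilinear form in either order (`apply_comm_of_abs_le`); by induction this extends to
regular forms in n variables (`iterate_comm`). Consequently, with all other arguments order
continuous, the Arens extension evaluated at y' depends on an order continuous argument z only
through z(w), for a fixed w in the order dual of that factor. Two consequences follow. First, all
permutations give the same extension, since such w is determined by the values at J x and everything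
agrees on J(E). Second, applying the same fact to a dominating positive form, replacing x'' by J x
in the outermost variable costs at most |J x - x''|(|w|), uniformly over |y'| ≤ U. This is
|σ|-convergence of the last limit, and induction gives the iterated formula. The formula with the
limits in the opposite order is the first formula for the reversed permutation. -/

namespace RieszDual

/-! ### Order dual calculus: Riesz–Kantorovich formulas, disjointness, decreasing nets. -/

section Basic

variable {E : Type u} [AddCommGroup E] [Lattice E] [IsOrderedAddMonoid E] [Module ℝ E]
  [IsOrderedModule ℝ E]

theorem apply_nonneg {f : RieszDual E} (hf : 0 ≤ f) {x : E} (hx : 0 ≤ x) : 0 ≤ f x := hf x hx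

theorem posPart_apply (f : RieszDual E) {x : E} (hx : 0 ≤ x) : f⁺ x = posValue f x := by
  have h : f⁺ = pos f := by
    change pos (f - 0) + 0 = pos f
    rw [sub_zero, add_zero]
  rw [h, pos_apply f hx]

theorem exists_lt_of_lt_posPart (f : RieszDual E) {x : E} (hx : 0 ≤ x) {c : ℝ} (hc : c < f⁺ x) :
    ∃ y, 0 ≤ y ∧ y ≤ x ∧ c < f y := by
  rw [posPart_apply f hx] at hc
  obtain ⟨_, ⟨y, hy, rfl⟩, h⟩ := (lt_isLUB_iff (isLUB_posValue f hx)).1 hc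
  exact ⟨y, hy.1, hy.2, h⟩

theorem abs_apply_le_of_forall (f : RieszDual E) {x : E} (hx : 0 ≤ x) {c : ℝ}
    (h : ∀ y, |y| ≤ x → f y ≤ c) : |f| x ≤ c := by
  rw [← posPart_add_negPart f, add_apply, ← posPart_neg, posPart_apply f hx,
    posPart_apply (-f) hx, ← le_sub_iff_add_le]
  refine posValue_le f hx fun y hy hyx => ?_
  rw [le_sub_comm]
  refine posValue_le (-f) hx fun z hz hzx => ?_
  have := h (y - z) (abs_le'.2 ⟨(sub_le_self y hz).trans hyx, by
    rw [neg_sub]; exact (sub_le_self z hy).trans hzx⟩)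
  rw [map_sub] at this
  rw [neg_apply]
  linarith

/-- Disjointness says f = (f - g)⁺, and the Riesz–Kantorovich supremum at x is nearly attained at
some y. There f (x - y) + g y < ε, so the required element is x - y. -/
theorem exists_of_inf_eq_zero {f g : RieszDual E} (h : f ⊓ g = 0) {x : E} (hx : 0 ≤ x) {ε : ℝ}
    (hε : 0 < ε) : ∃ y, 0 ≤ y ∧ y ≤ x ∧ f y < ε ∧ g (x - y) < ε := by
  have hf : 0 ≤ f := h ▸ inf_le_left
  have hg : 0 ≤ g := h ▸ inf_le_right
  have h1 : f - (f - g)⁺ = 0 := by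
    rw [← h]
    change f - (pos (f - g - 0) + 0) = f - pos (f - g)
    rw [sub_zero, add_zero]
  have h2 : f x - ε < (f - g)⁺ x := by
    rw [← sub_eq_zero.1 h1]
    linarith
  obtain ⟨y, hy, hyx, hlt⟩ := exists_lt_of_lt_posPart _ hx h2
  rw [sub_apply] at hlt
  have h3 := apply_nonneg hf (sub_nonneg.2 hyx)
  have h4 := apply_nonneg hg hy
  rw [map_sub] at h3
  refine ⟨x - y, sub_nonneg.2 hyx, sub_le_self _ hy, ?_, ?_⟩
  · rw [map_sub]; linarith
  · rw [sub_sub_cancel]; linarith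

/-- A decreasing net of positive functionals has an infimum, which is computed pointwise on the
positive cone. -/
theorem exists_tendsto_of_antitone {I : Type*} [Preorder I] [IsDirectedOrder I] [Nonempty I]
    {f : I → RieszDual E} (hf : Antitone f) (h0 : ∀ i, 0 ≤ f i) :
    ∃ r : RieszDual E, 0 ≤ r ∧ IsGLB (Set.range f) r ∧
      ∀ x, 0 ≤ x → Tendsto (fun i => f i x) atTop (𝓝 (r x)) := by
  have ht : ∀ x, 0 ≤ x → Tendsto (fun i => f i x) atTop (𝓝 (⨅ i, f i x)) := fun x hx =>
    tendsto_atTop_ciInf (fun i j hij => hf hij x hx) ⟨0, by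
      rintro _ ⟨i, rfl⟩
      exact apply_nonneg (h0 i) hx⟩
  have hadd : ∀ x y, 0 ≤ x → 0 ≤ y → (⨅ i, f i (x + y)) = (⨅ i, f i x) + ⨅ i, f i y :=
    fun x y hx hy => tendsto_nhds_unique (ht _ (add_nonneg hx hy)) (by
      simpa only [map_add] using (ht x hx).add (ht y hy))
  have hsmul : ∀ (c : ℝ) (x : E), 0 ≤ c → 0 ≤ x → (⨅ i, f i (c • x)) = c * ⨅ i, f i x :=
    fun c x hc hx => tendsto_nhds_unique (ht _ (smul_nonneg hc hx)) (by
      simpa only [map_smul] using (ht x hx).const_mul c)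
  have hnn : ∀ x, 0 ≤ x → 0 ≤ coneExtension (fun x => ⨅ i, f i x) hadd hsmul x := fun x hx => by
    rw [coneExtension_apply_of_nonneg _ _ _ hx]
    exact le_ciInf fun i => apply_nonneg (h0 i) hx
  have hr : ∀ x, 0 ≤ x → Tendsto (fun i => f i x) atTop
      (𝓝 (mk (coneExtension (fun x => ⨅ i, f i x) hadd hsmul) (mem_of_nonneg _ hnn) x)) := fun x hx => by
    rw [mk_apply, coneExtension_apply_of_nonneg _ _ _ hx]
    exact ht x hx
  refine ⟨mk (coneExtension (fun x => ⨅ i, f i x) hadd hsmul) (mem_of_nonneg _ hnn), hnn, ⟨?_, ?_⟩, hr⟩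
  · rintro _ ⟨i, rfl⟩ x hx
    exact le_of_tendsto (hr x hx) ((eventually_ge_atTop i).mono fun j hij => hf hij x hx)
  · intro g hg x hx
    exact ge_of_tendsto (hr x hx) (Eventually.of_forall fun i => hg ⟨i, rfl⟩ x hx)

theorem tendsto_apply_of_isGLB_zero {I : Type*} [Preorder I] [IsDirectedOrder I] [Nonempty I]
    {f : I → RieszDual E} (hf : Antitone f) (h0 : IsGLB (Set.range f) 0) {x : E} (hx : 0 ≤ x) :
    Tendsto (fun i => f i x) atTop (𝓝 0) := by
  obtain ⟨r, -, hr, ht⟩ := exists_tendsto_of_antitone hf fun i => h0.1 ⟨i, rfl⟩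
  have := ht x hx
  rwa [hr.unique h0] at this

end Basic

/-! ### Order continuous functionals form an ideal. -/

section OrderContinuous

variable {G : Type u} [AddCommGroup G] [Lattice G] [IsOrderedAddMonoid G] [Module ℝ G]
  [IsOrderedModule ℝ G]

theorem isOrderContinuous_of_nonneg {f : RieszDual G} (hf : 0 ≤ f)
    (h : ∀ (I : Type u) [Preorder I] [IsDirectedOrder I] [Nonempty I] (y : I → G),
      Antitone y → IsGLB (Set.range y) 0 → Tendsto (fun i => f (y i)) atTop (𝓝 0)) :
    IsOrderContinuousFunctional f := by
  intro I _ _ _ x y hy h0 hxy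
  refine squeeze_zero_norm (fun i => ?_) (h I y hy h0)
  have := abs_apply_le (f := f) (hxy i)
  rwa [abs_of_nonneg hf] at this

end OrderContinuous

end RieszDual

namespace IsOrderContinuousFunctional

open RieszDual

variable {G : Type u} [AddCommGroup G] [Lattice G] [IsOrderedAddMonoid G] [Module ℝ G]
  [IsOrderedModule ℝ G]

theorem tendsto {f : RieszDual G} (hf : IsOrderContinuousFunctional f) {I : Type u} [Preorder I]
    [IsDirectedOrder I] [Nonempty I] {y : I → G} (hy : Antitone y)
    (h0 : IsGLB (Set.range y) 0) : Tendsto (fun i => f (y i)) atTop (𝓝 0) :=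
  hf I y y hy h0 fun i => (abs_of_nonneg (h0.1 ⟨i, rfl⟩)).le

theorem neg {f : RieszDual G} (hf : IsOrderContinuousFunctional f) :
    IsOrderContinuousFunctional (-f) := by
  intro I _ _ _ x y hy h0 hxy
  simpa only [RieszDual.neg_apply, neg_zero] using (hf I x y hy h0 hxy).neg

theorem add {f g : RieszDual G} (hf : IsOrderContinuousFunctional f)
    (hg : IsOrderContinuousFunctional g) : IsOrderContinuousFunctional (f + g) := by
  intro I _ _ _ x y hy h0 hxy
  simpa only [RieszDual.add_apply, add_zero] using (hf I x y hy h0 hxy).add (hg I x y hy h0 hxy)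

theorem sub {f g : RieszDual G} (hf : IsOrderContinuousFunctional f)
    (hg : IsOrderContinuousFunctional g) : IsOrderContinuousFunctional (f - g) := by
  rw [sub_eq_add_neg]
  exact hf.add hg.neg

theorem posPart {f : RieszDual G} (hf : IsOrderContinuousFunctional f) :
    IsOrderContinuousFunctional f⁺ := by
  refine isOrderContinuous_of_nonneg (posPart_nonneg f) ?_
  intro I _ _ _ y hy h0
  have hy0 : ∀ i, 0 ≤ y i := fun i => h0.1 ⟨i, rfl⟩
  rw [Metric.tendsto_nhds]
  intro ε hε
  obtain ⟨i₀⟩ := ‹Nonempty I›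
  -- Here f z almost attains f⁺ (y i₀). Since z - z ⊓ y i ≤ y i₀ - y i, it follows that f⁺ (y i) ≤
  -- (f⁺ (y i₀) - f z) + f (z ⊓ y i). The bracket is below ε / 2, and the last term tends to 0
  -- because z ⊓ y i decreases to 0.
  obtain ⟨z, hz, hzy, hlt⟩ := exists_lt_of_lt_posPart f (hy0 i₀) (sub_lt_self (f⁺ (y i₀)) (half_pos hε))
  have hmin : IsGLB (Set.range fun i => z ⊓ y i) 0 := by
    refine ⟨?_, fun l hl => h0.2 ?_⟩
    · rintro _ ⟨i, rfl⟩
      exact le_inf hz (hy0 i)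
    · rintro _ ⟨i, rfl⟩
      exact (hl ⟨i, rfl⟩).trans inf_le_right
  have ht := hf.tendsto (fun i j hij => inf_le_inf_left z (hy hij)) hmin
  filter_upwards [Metric.tendsto_nhds.1 ht (ε / 2) (half_pos hε), eventually_ge_atTop i₀]
    with i h2 hi
  rw [Real.dist_eq, sub_zero] at h2 ⊢
  rw [_root_.abs_of_nonneg (apply_nonneg (posPart_nonneg f) (hy0 i))]
  have h3 : z - z ⊓ y i ≤ y i₀ - y i := by
    rw [sub_inf, sub_self]
    exact sup_le (sub_nonneg.2 (hy (hi))) (sub_le_sub_right hzy _)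
  have h4 := (le_posPart f) _ (sub_nonneg.2 (inf_le_left : z ⊓ y i ≤ z))
  have h5 := mono_of_nonneg (posPart_nonneg f) h3
  rw [RieszDual.map_sub, RieszDual.map_sub] at h4
  rw [RieszDual.map_sub, RieszDual.map_sub] at h5
  linarith [(abs_lt.1 h2).2]

theorem negPart {f : RieszDual G} (hf : IsOrderContinuousFunctional f) :
    IsOrderContinuousFunctional f⁻ := by
  rw [← posPart_neg]
  exact hf.neg.posPart

theorem abs {f : RieszDual G} (hf : IsOrderContinuousFunctional f) :
    IsOrderContinuousFunctional |f| := by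
  rw [← posPart_add_negPart f]
  exact hf.posPart.add hf.negPart

theorem of_le {f g : RieszDual G} (hg : IsOrderContinuousFunctional g) (hf : 0 ≤ f) (hfg : f ≤ g) :
    IsOrderContinuousFunctional f := by
  refine isOrderContinuous_of_nonneg hf ?_
  intro I _ _ _ y hy h0
  have hy0 : ∀ i, 0 ≤ y i := fun i => h0.1 ⟨i, rfl⟩
  exact squeeze_zero (fun i => apply_nonneg hf (hy0 i)) (fun i => hfg _ (hy0 i))
    (hg.tendsto hy h0)

end IsOrderContinuousFunctional

namespace RieszDual

/-! ### Null functionals, disjointness and truncation by elements of J(E). -/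

section Canonical

variable {E : Type u} [AddCommGroup E] [Lattice E] [IsOrderedAddMonoid E] [Module ℝ E]
  [IsOrderedModule ℝ E]

instance : Nonempty {d : E // 0 ≤ d} := ⟨0, le_rfl⟩

instance : IsDirectedOrder {d : E // 0 ≤ d} :=
  ⟨fun a b => ⟨⟨a.1 ⊔ b.1, a.2.trans le_sup_left⟩, le_sup_left (a := a.1), le_sup_right (a := a.1)⟩⟩

theorem canonicalJ_add (x y : E) : canonicalJ (x + y) = canonicalJ x + canonicalJ y :=
  DFunLike.ext _ _ fun f => map_add f x y

theorem canonicalJ_sub (x y : E) : canonicalJ (x - y) = canonicalJ x - canonicalJ y :=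
  DFunLike.ext _ _ fun f => map_sub f x y

theorem canonicalJ_nonneg {x : E} (hx : 0 ≤ x) : 0 ≤ canonicalJ x := fun _ hf => hf x hx

theorem canonicalJ_mono {x y : E} (h : x ≤ y) : canonicalJ x ≤ canonicalJ y :=
  fun _ hf => mono_of_nonneg hf h

/-- A net in the order dual decreasing to 0 does so pointwise at each positive x, which is order
continuity of J x. The general case is a difference of two such. -/
theorem isOrderContinuous_canonicalJ (x : E) : IsOrderContinuousFunctional (canonicalJ x) := by
  have key : ∀ x : E, 0 ≤ x → IsOrderContinuousFunctional (canonicalJ x) := fun x hx =>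
    isOrderContinuous_of_nonneg (canonicalJ_nonneg hx) fun I _ _ _ y hy h0 =>
      tendsto_apply_of_isGLB_zero hy h0 hx
  rw [← posPart_sub_negPart x, canonicalJ_sub]
  exact (key _ (posPart_nonneg x)).sub (key _ (negPart_nonneg x))

/-- Among the functionals in `[0, u]` on which `φ` vanishes there is a largest one. -/
theorem exists_maximal_null {φ : RieszBidual E} (hφ : IsOrderContinuousFunctional φ)
    (hφ0 : 0 ≤ φ) {u : RieszDual E} (hu : 0 ≤ u) :
    ∃ s, 0 ≤ s ∧ s ≤ u ∧ φ s = 0 ∧ ∀ h, 0 ≤ h → s + h ≤ u → φ h = 0 → h = 0 := by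
  let S := {h : RieszDual E // 0 ≤ h ∧ h ≤ u ∧ φ h = 0}
  have hne : Nonempty S := ⟨0, le_rfl, hu, map_zero φ⟩
  have hdir : IsDirectedOrder S := ⟨fun a b => by
    refine ⟨⟨a.1 ⊔ b.1, a.2.1.trans le_sup_left, sup_le a.2.2.1 b.2.2.1, ?_⟩,
      le_sup_left (a := a.1), le_sup_right (a := a.1)⟩
    have h1 : a.1 ⊔ b.1 ≤ a.1 + b.1 :=
      sup_le (le_add_of_nonneg_right b.2.1) (le_add_of_nonneg_left a.2.1)
    have h2 := mono_of_nonneg hφ0 h1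
    rw [map_add, a.2.2.2, b.2.2.2, add_zero] at h2
    exact le_antisymm h2 (apply_nonneg hφ0 (a.2.1.trans le_sup_left))⟩
  have hanti : Antitone fun h : S => u - h.1 := fun a b hab => sub_le_sub_left (show a.1 ≤ b.1 from hab) u
  obtain ⟨r, hr0, hr, -⟩ := exists_tendsto_of_antitone hanti fun h => sub_nonneg.2 h.2.2.1
  -- S is directed upwards, and r is the infimum of the u - h, so u - r is the supremum of S.
  have hle : ∀ h : S, h.1 ≤ u - r := fun h => le_sub_comm.1 (hr.1 ⟨h, rfl⟩)
  have hs0 : 0 ≤ u - r := hle ⟨0, le_rfl, hu, map_zero φ⟩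
  have hφs : φ (u - r) = 0 := by
    -- The elements u - r - h decrease to 0, while φ takes the constant value φ (u - r) on them; so
    -- this constant is 0.
    have ht := hφ.tendsto (I := S) (y := fun h => u - r - h.1)
      (fun a b hab => sub_le_sub_left (show a.1 ≤ b.1 from hab) _) (by
        refine ⟨?_, fun l hl => ?_⟩
        · rintro _ ⟨h, rfl⟩
          exact sub_nonneg.2 (hle h)
        · have : l + r ≤ r := hr.2 (by
            rintro _ ⟨h, rfl⟩
            have h1 : l ≤ u - r - h.1 := hl ⟨h, rfl⟩
            have h2 := add_le_add_left h1 r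
            rwa [sub_right_comm, sub_add_cancel] at h2)
          simpa using this)
    refine tendsto_nhds_unique (f := fun _ : S => φ (u - r)) (l := atTop) tendsto_const_nhds ?_
    refine ht.congr fun h => ?_
    rw [map_sub φ (u - r), h.2.2.2, sub_zero]
  refine ⟨u - r, hs0, sub_le_self _ hr0, hφs, fun h hh hle' hφh => ?_⟩
  have := hle ⟨u - r + h, add_nonneg hs0 hh, hle', by rw [map_add, hφs, hφh, add_zero]⟩
  exact le_antisymm (by simpa using this) hh

/-- If `φ` and `ψ` are disjoint and `φ` is strictly positive on `[0, f]`, then `ψ f = 0`. -/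
theorem apply_eq_zero_of_disjoint {φ ψ : RieszBidual E} (hψ : IsOrderContinuousFunctional ψ)
    (h : φ ⊓ ψ = 0) {f : RieszDual E} (hf : 0 ≤ f)
    (hpos : ∀ g, 0 ≤ g → g ≤ f → φ g = 0 → g = 0) : ψ f = 0 := by
  have hφ0 : 0 ≤ φ := h ▸ inf_le_left
  have hψ0 : 0 ≤ ψ := h ▸ inf_le_right
  refine le_antisymm (le_of_forall_pos_le_add fun δ hδ => ?_) (apply_nonneg hψ0 hf)
  rw [zero_add]
  -- The bounds δ / 2 ^ (n + 1) sum to δ. The meets k n of g 0, …, g n then satisfy φ (k n) → 0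
  -- while ψ (f - k n) stays below δ.
  have hex : ∀ n : ℕ, ∃ y, 0 ≤ y ∧ y ≤ f ∧ φ y < δ / 2 / 2 ^ n ∧ ψ (f - y) < δ / 2 / 2 ^ n :=
    fun n => exists_of_inf_eq_zero h hf (by positivity)
  choose g hg0 hgf hφg hψg using hex
  let k : ℕ → RieszDual E := fun n => Nat.rec (g 0) (fun n r => r ⊓ g (n + 1)) n
  have hks : ∀ n, k (n + 1) = k n ⊓ g (n + 1) := fun n => rfl
  have hk0 : ∀ n, 0 ≤ k n := fun n => by
    induction n with
    | zero => exact hg0 0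
    | succ n ih => rw [hks]; exact le_inf ih (hg0 _)
  have hkg : ∀ n, k n ≤ g n := fun n => by
    cases n with
    | zero => exact le_rfl
    | succ n => rw [hks]; exact inf_le_right
  have hanti : Antitone k := antitone_nat_of_succ_le fun n => by rw [hks]; exact inf_le_left
  have hsum : ∀ n, ψ (f - k n) ≤ δ - δ / 2 / 2 ^ n := fun n => by
    induction n with
    | zero =>
      refine (hψg 0).le.trans (le_of_eq ?_)
      ring
    | succ n ih =>
      have h1 : f - k (n + 1) ≤ (f - k n) + (f - g (n + 1)) := by
        rw [hks, sub_inf]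
        exact sup_le (le_add_of_nonneg_right (sub_nonneg.2 (hgf _)))
          (le_add_of_nonneg_left (sub_nonneg.2 ((hkg n).trans (hgf n))))
      have h2 := mono_of_nonneg hψ0 h1
      rw [map_add] at h2
      have h3 := hψg (n + 1)
      have h4 : δ / 2 / 2 ^ n = 2 * (δ / 2 / 2 ^ (n + 1)) := by rw [pow_succ]; field_simp
      linarith
  -- A lower bound l of all k n has φ l⁺ = 0, so l⁺ = 0 by strict positivity of φ on [0, f]. The
  -- index set is lifted because order continuity quantifies over index types in the universe of the
  -- space.
  have hglb : IsGLB (Set.range fun n : ULift.{u} ℕ => k n.down) 0 := by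
    refine ⟨?_, fun l hl => ?_⟩
    · rintro _ ⟨n, rfl⟩
      exact hk0 _
    · have hlk : ∀ n, l⁺ ≤ k n := fun n => sup_le (hl ⟨⟨n⟩, rfl⟩) (hk0 n)
      have hz : φ l⁺ = 0 := by
        refine le_antisymm ?_ (apply_nonneg hφ0 (posPart_nonneg l))
        have ht : Tendsto (fun n : ℕ => δ / 2 / 2 ^ n) atTop (𝓝 0) := by
          simpa [div_eq_mul_inv] using (tendsto_pow_atTop_nhds_zero_of_lt_one
            (r := (2 : ℝ)⁻¹) (by norm_num) (by norm_num)).const_mul (δ / 2)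
        exact ge_of_tendsto ht (Eventually.of_forall fun n =>
          (mono_of_nonneg hφ0 ((hlk n).trans (hkg n))).trans (hφg n).le)
      have := hpos l⁺ (posPart_nonneg l) ((hlk 0).trans (hgf 0)) hz
      exact posPart_eq_zero.1 this
  have ht := hψ.tendsto (fun a b hab => hanti hab) hglb
  have ht' : Tendsto (fun n : ULift.{u} ℕ => ψ f - ψ (k n.down)) atTop (𝓝 (ψ f - 0)) :=
    tendsto_const_nhds.sub ht
  rw [sub_zero] at ht'
  refine le_of_tendsto ht' (Eventually.of_forall fun n => ?_)
  have := hsum n.down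
  rw [map_sub] at this
  have : 0 < δ / 2 / 2 ^ n.down := by positivity
  linarith

/-- Take u₁ to be the largest part of u on which φ vanishes. Then φ is strictly positive on [0, u -
u₁], which forces ψ to vanish at u - u₁. The meet of the two parts is φ-null and could be added to
u₁, so it is 0. -/
theorem exists_disjoint_decomposition {φ ψ : RieszBidual E} (hφ : IsOrderContinuousFunctional φ)
    (hψ : IsOrderContinuousFunctional ψ) (h : φ ⊓ ψ = 0) {u : RieszDual E} (hu : 0 ≤ u) :
    ∃ u₁ u₂, 0 ≤ u₁ ∧ 0 ≤ u₂ ∧ u₁ + u₂ = u ∧ u₁ ⊓ u₂ = 0 ∧ φ u₁ = 0 ∧ ψ u₂ = 0 := by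
  have hφ0 : 0 ≤ φ := h ▸ inf_le_left
  obtain ⟨s, hs0, hsu, hφs, hmax⟩ := exists_maximal_null hφ hφ0 hu
  have hd : 0 ≤ u - s := sub_nonneg.2 hsu
  refine ⟨s, u - s, hs0, hd, add_sub_cancel _ _, ?_, hφs, ?_⟩
  · refine hmax _ (le_inf hs0 hd) ?_ ?_
    · rw [← le_sub_iff_add_le']
      exact inf_le_right
    · refine le_antisymm ?_ (apply_nonneg hφ0 (le_inf hs0 hd))
      rw [← hφs]
      exact mono_of_nonneg hφ0 inf_le_left
  · refine apply_eq_zero_of_disjoint hψ h hd fun g hg hgs hφg => hmax g hg ?_ hφg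
    rwa [← le_sub_iff_add_le']

/-- Remove from f its largest r-null part s. On [0, f - s] the functional r is strictly positive, so
every J x with x ≥ 0, being disjoint from r, kills f - s. Thus f = s and r f = 0. -/
theorem eq_zero_of_disjoint_canonicalJ {r : RieszBidual E} (hr : IsOrderContinuousFunctional r)
    (hr0 : 0 ≤ r) (h : ∀ x, 0 ≤ x → r ⊓ canonicalJ x = 0) : r = 0 := by
  refine ext_of_nonneg fun f hf => ?_
  obtain ⟨s, hs0, hsf, hrs, hmax⟩ := exists_maximal_null hr hr0 hf
  have hd : f - s = 0 := ext_of_nonneg fun x hx =>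
    apply_eq_zero_of_disjoint (isOrderContinuous_canonicalJ x) (h x hx) (sub_nonneg.2 hsf)
      fun g hg hgs hrg => hmax g hg (by rwa [← le_sub_iff_add_le']) hrg
  rw [sub_eq_zero.1 hd, hrs, zero_apply]

/-- The truncations `z ⊓ J d` of a positive order continuous `z` tend to `z`. -/
theorem tendsto_posPart_sub_canonicalJ {z : RieszBidual E} (hz : IsOrderContinuousFunctional z)
    (hz0 : 0 ≤ z) {u : RieszDual E} (hu : 0 ≤ u) :
    Tendsto (fun d : {d : E // 0 ≤ d} => (z - canonicalJ d.1)⁺ u) atTop (𝓝 0) := by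
  have hanti : Antitone fun d : {d : E // 0 ≤ d} => (z - canonicalJ d.1)⁺ := fun a b hab =>
    posPart_mono (sub_le_sub_left (canonicalJ_mono hab) z)
  obtain ⟨r, hr0, hr, ht⟩ := exists_tendsto_of_antitone hanti fun d => posPart_nonneg _
  have hrz : r ≤ z := (hr.1 ⟨⟨0, le_rfl⟩, rfl⟩).trans
    (sup_le (sub_le_self z (canonicalJ_nonneg le_rfl)) hz0)
  have : r = 0 := eq_zero_of_disjoint_canonicalJ (hz.of_le hr0 hrz) hr0 fun x hx => by
    refine le_antisymm ?_ (le_inf hr0 (canonicalJ_nonneg hx))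
    -- Enlarging d to d + x lowers (z - J d)⁺ by at least (z - J d)⁺ ⊓ J x. Hence r + r ⊓ J x is
    -- still a lower bound of the net, and r is the greatest one.
    have h1 : r + r ⊓ canonicalJ x ≤ r := hr.2 (by
      rintro _ ⟨d, rfl⟩
      have h2 : r ≤ (z - canonicalJ (d.1 + x))⁺ := hr.1 ⟨⟨d.1 + x, add_nonneg d.2 hx⟩, rfl⟩
      have h3 : r ≤ (z - canonicalJ d.1)⁺ := hr.1 ⟨d, rfl⟩
      have h4 : (z - canonicalJ (d.1 + x))⁺ ≤ (z - canonicalJ d.1)⁺ -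
          (z - canonicalJ d.1)⁺ ⊓ canonicalJ x := by
        rw [sub_inf, sub_self, canonicalJ_add, ← sub_sub]
        refine sup_le (le_sup_of_le_right (sub_le_sub_right (le_posPart _) _)) le_sup_left
      have h5 : r ⊓ canonicalJ x ≤ (z - canonicalJ d.1)⁺ ⊓ canonicalJ x := inf_le_inf_right _ h3
      exact (add_le_add (h2.trans h4) h5).trans (sub_add_cancel _ _).le)
    simpa using h1
  have h := ht u hu
  rwa [this, zero_apply] at h

end Canonical

end RieszDual

/-! ### Density of J(E) among the order continuous functionals. -/

namespace RieszDual

theorem abs_sub_le_add {G : Type*} [AddCommGroup G] [Lattice G] [IsOrderedAddMonoid G] (a b : G) :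
    |a - b| ≤ |a| + |b| := by
  rw [sub_eq_add_neg, ← abs_neg b]
  exact abs_add_le a (-b)

section Density

variable {E : Type u} [AddCommGroup E] [Lattice E] [IsOrderedAddMonoid E] [Module ℝ E]
  [IsOrderedModule ℝ E]

/-- Split u into u₁, where z⁻ vanishes, and u₂, where z⁺ vanishes. Disjointness of u₁ and u₂ yields
y in [0, 2e] that is nearly 2e as seen by u₁ and nearly 0 as seen by u₂. So x = y - e behaves like e
where z lies in [0, 2e] and like -e where z lies in [-2e, 0], leaving an error of at most e on each
side, up to ε. -/
theorem exists_canonicalJ_near_half {z : RieszBidual E} (hz : IsOrderContinuousFunctional z)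
    {e : E} (he : 0 ≤ e) (hze : |z| ≤ canonicalJ (e + e)) {u : RieszDual E} (hu : 0 ≤ u) {ε : ℝ}
    (hε : 0 < ε) : ∃ x : E, (|z - canonicalJ x| - canonicalJ e)⁺ u < ε := by
  have hc := canonicalJ_nonneg he
  obtain ⟨u₁, u₂, hu₁, hu₂, rfl, hdisj, hz₁, hz₂⟩ := exists_disjoint_decomposition hz.negPart
    hz.posPart (by rw [inf_comm]; exact posPart_inf_negPart_eq_zero z) hu
  obtain ⟨y, hy0, hye, hy₂, hy₁⟩ := exists_of_inf_eq_zero (f := u₂) (g := u₁)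
    (by rw [inf_comm]; exact hdisj) (add_nonneg he he) (half_pos hε)
  have hbound : ∀ p : RieszBidual E, 0 ≤ p → p ≤ |z| → |p - canonicalJ e| ≤ canonicalJ e := by
    intro p hp hpz
    rw [abs_le', neg_sub, sub_le_iff_le_add, ← canonicalJ_add]
    exact ⟨hpz.trans hze, sub_le_self _ hp⟩
  have hp := hbound z⁺ (posPart_nonneg z) (sup_le (le_abs_self z) (abs_nonneg z))
  have hn := hbound z⁻ (negPart_nonneg z) (sup_le (neg_le_abs z) (abs_nonneg z))
  have hy := canonicalJ_nonneg hy0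
  have hy' := canonicalJ_nonneg (sub_nonneg.2 hye)
  have h₁ : (|z - canonicalJ (y - e)| - canonicalJ e)⁺ ≤ z⁻ + canonicalJ (e + e - y) := by
    refine sup_le ?_ (add_nonneg (negPart_nonneg z) hy')
    have h : z - canonicalJ (y - e) = (z⁺ - canonicalJ e) + (canonicalJ (e + e - y) - z⁻) := by
      nth_rewrite 1 [← posPart_sub_negPart z]
      simp only [canonicalJ_add, canonicalJ_sub]
      abel
    rw [h, sub_le_iff_le_add, add_comm _ (canonicalJ e), add_comm (z⁻)]
    refine (abs_add_le _ _).trans (add_le_add hp ((abs_sub_le_add _ _).trans (le_of_eq ?_)))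
    rw [abs_of_nonneg hy', abs_of_nonneg (negPart_nonneg z)]
  have h₂ : (|z - canonicalJ (y - e)| - canonicalJ e)⁺ ≤ z⁺ + canonicalJ y := by
    refine sup_le ?_ (add_nonneg (posPart_nonneg z) hy)
    have h : z - canonicalJ (y - e) = (z⁺ - canonicalJ y) - (z⁻ - canonicalJ e) := by
      nth_rewrite 1 [← posPart_sub_negPart z]
      simp only [canonicalJ_sub]
      abel
    rw [h, sub_le_iff_le_add]
    refine (abs_sub_le_add _ _).trans (add_le_add ((abs_sub_le_add _ _).trans (le_of_eq ?_)) hn)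
    rw [abs_of_nonneg hy, abs_of_nonneg (posPart_nonneg z)]
  refine ⟨y - e, ?_⟩
  have h₃ := h₁ u₁ hu₁
  have h₄ := h₂ u₂ hu₂
  rw [add_apply, canonicalJ_apply] at h₃ h₄
  rw [map_add]
  linarith

/-- Each halving step replaces z by a remainder w = z - J x that lies in [-J c, J c] with c = e / 2,
except for a small excess at u. Clipping w to this interval allows the step to be repeated. -/
theorem exists_canonicalJ_near_of_abs_le {u : RieszDual E} (hu : 0 ≤ u) (n : ℕ) :
    ∀ {e : E}, 0 ≤ e → ∀ {z : RieszBidual E}, IsOrderContinuousFunctional z →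
      |z| ≤ canonicalJ e → ∀ {ε : ℝ}, 0 < ε →
        ∃ x : E, |z - canonicalJ x| u ≤ u e / 2 ^ n + ε := by
  induction n with
  | zero =>
    intro e _ z _ hze ε hε
    refine ⟨0, ?_⟩
    have h0 : canonicalJ (0 : E) = 0 := by rw [← sub_self (0 : E), canonicalJ_sub, sub_self]
    rw [h0, sub_zero, pow_zero, div_one]
    have := hze u hu
    rw [canonicalJ_apply] at this
    linarith
  | succ n ih =>
    intro e he z hz hze ε hε
    obtain ⟨c, rfl⟩ : ∃ c : E, c + c = e := ⟨(1 / 2 : ℝ) • e, by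
      rw [← add_smul]; norm_num⟩
    have hc : 0 ≤ c := by
      have := smul_nonneg (by norm_num : (0 : ℝ) ≤ 1 / 2) he
      rwa [← two_smul ℝ c, smul_smul, one_div, inv_mul_cancel₀ (two_ne_zero' ℝ), one_smul] at this
    -- The tolerance ε / 4 is spent twice, in clipping w⁺ and in clipping w⁻; the induction
    -- hypothesis uses the other ε / 2.
    obtain ⟨x, hx⟩ := exists_canonicalJ_near_half hz hc hze hu
      (ε := ε / 4) (by positivity)
    have hw := hz.sub (isOrderContinuous_canonicalJ x)
    set w := z - canonicalJ x
    have hJc := canonicalJ_nonneg hc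
    have hp0 : 0 ≤ w⁺ ⊓ canonicalJ c := le_inf (posPart_nonneg w) hJc
    have hn0 : 0 ≤ w⁻ ⊓ canonicalJ c := le_inf (negPart_nonneg w) hJc
    obtain ⟨x', hx'⟩ := ih hc (z := w⁺ ⊓ canonicalJ c - w⁻ ⊓ canonicalJ c)
      ((hw.posPart.of_le hp0 inf_le_left).sub (hw.negPart.of_le hn0 inf_le_left))
      (by
        rw [abs_le', neg_sub]
        exact ⟨(sub_le_self _ hn0).trans inf_le_right, (sub_le_self _ hp0).trans inf_le_right⟩)
      (half_pos hε)
    refine ⟨x + x', ?_⟩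
    have hcut : ∀ p : RieszBidual E, p ≤ |w| → |p - p ⊓ canonicalJ c| ≤ (|w| - canonicalJ c)⁺ := by
      intro p hp
      rw [abs_of_nonneg (sub_nonneg.2 inf_le_left), sub_inf, sub_self]
      exact sup_le (posPart_nonneg _) ((sub_le_sub_right hp _).trans (le_posPart _))
    have h1 : z - canonicalJ (x + x') = ((w⁺ - w⁺ ⊓ canonicalJ c) - (w⁻ - w⁻ ⊓ canonicalJ c)) +
        (w⁺ ⊓ canonicalJ c - w⁻ ⊓ canonicalJ c - canonicalJ x') := by
      have : z - canonicalJ (x + x') = w - canonicalJ x' := by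
        rw [canonicalJ_add, ← sub_sub]
      rw [this]
      nth_rewrite 1 [← posPart_sub_negPart w]
      abel
    have h2 : |z - canonicalJ (x + x')| ≤ (|w| - canonicalJ c)⁺ + (|w| - canonicalJ c)⁺ +
        |w⁺ ⊓ canonicalJ c - w⁻ ⊓ canonicalJ c - canonicalJ x'| := by
      rw [h1]
      refine (abs_add_le _ _).trans (add_le_add_left ((abs_sub_le_add _ _).trans (add_le_add ?_ ?_)) _)
      · exact hcut _ (sup_le (le_abs_self w) (abs_nonneg w))
      · exact hcut _ (sup_le (neg_le_abs w) (abs_nonneg w))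
    have h3 := h2 u hu
    rw [add_apply, add_apply] at h3
    rw [map_add]
    have h4 : (u c + u c) / 2 ^ (n + 1) = u c / 2 ^ n := by rw [pow_succ]; field_simp; ring
    linarith

/-- The image of `E` is dense in the order continuous functionals on the order dual. -/
theorem exists_canonicalJ_near {z : RieszBidual E} (hz : IsOrderContinuousFunctional z)
    {u : RieszDual E} (hu : 0 ≤ u) {ε : ℝ} (hε : 0 < ε) : ∃ x : E, |z - canonicalJ x| u < ε := by
  have key : ∀ {z : RieszBidual E}, IsOrderContinuousFunctional z → 0 ≤ z → ∀ {ε : ℝ}, 0 < ε →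
      ∃ x : E, |z - canonicalJ x| u < ε := by
    intro z hz hz0 ε hε
    -- The three thirds of ε pay for truncating z at J d, for the bound u d / 2 ^ n left after n
    -- halvings, and for the tolerance of the halvings.
    obtain ⟨⟨d, hd⟩, hdε⟩ := ((tendsto_posPart_sub_canonicalJ hz hz0 hu).eventually_lt_const
      (by positivity : 0 < ε / 3)).exists
    have ht : Tendsto (fun n : ℕ => u d / 2 ^ n) atTop (𝓝 0) := by
      simpa [div_eq_mul_inv] using (tendsto_pow_atTop_nhds_zero_of_lt_one
        (r := (2 : ℝ)⁻¹) (by norm_num) (by norm_num)).const_mul (u d)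
    obtain ⟨n, hn⟩ := (ht.eventually_lt_const (by positivity : 0 < ε / 3)).exists
    have h0 : 0 ≤ z ⊓ canonicalJ d := le_inf hz0 (canonicalJ_nonneg hd)
    obtain ⟨x, hx⟩ := exists_canonicalJ_near_of_abs_le hu n hd (hz.of_le h0 inf_le_left)
      (by rw [abs_of_nonneg h0]; exact inf_le_right) (by positivity : 0 < ε / 3)
    refine ⟨x, ?_⟩
    have h1 : |z - canonicalJ x| ≤ (z - canonicalJ d)⁺ + |z ⊓ canonicalJ d - canonicalJ x| := by
      rw [← sub_add_sub_cancel z (z ⊓ canonicalJ d)]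
      refine (abs_add_le _ _).trans (add_le_add_left (le_of_eq ?_) _)
      rw [abs_of_nonneg (sub_nonneg.2 inf_le_left), sub_inf, sub_self, sup_comm]
      rfl
    have h2 := h1 u hu
    rw [add_apply] at h2
    dsimp only at hdε
    linarith
  obtain ⟨x, hx⟩ := key hz.posPart (posPart_nonneg z) (half_pos hε)
  obtain ⟨y, hy⟩ := key hz.negPart (negPart_nonneg z) (half_pos hε)
  refine ⟨x - y, ?_⟩
  have h1 : |z - canonicalJ (x - y)| ≤ |z⁺ - canonicalJ x| + |z⁻ - canonicalJ y| := by
    nth_rewrite 1 [← posPart_sub_negPart z]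
    rw [canonicalJ_sub, sub_sub_sub_comm]
    exact abs_sub_le_add _ _
  have h2 := h1 u hu
  rw [add_apply] at h2
  linarith

theorem tendsto_iff_abs_sub {I : Type*} {l : Filter I} {f : I → RieszDual E} {g : RieszDual E} :
    Tendsto f l (𝓝 g) ↔ ∀ x, 0 ≤ x → Tendsto (fun i => |f i - g| x) l (𝓝 0) := by
  rw [withSeminorms.tendsto_nhds]
  constructor
  · intro h x hx
    refine Metric.tendsto_nhds.2 fun ε hε => (h x ε hε).mono fun i hi => ?_
    change |f i - g| |x| < ε at hi
    rw [abs_of_nonneg hx] at hi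
    rw [Real.dist_eq, sub_zero, _root_.abs_of_nonneg (apply_nonneg (abs_nonneg _) hx)]
    exact hi
  · intro h x ε hε
    exact (h |x| (abs_nonneg x)).eventually_lt_const hε

theorem exists_net_tendsto {z : RieszBidual E} (hz : IsOrderContinuousFunctional z) :
    ∃ (I : Type u) (_ : Preorder I) (_ : IsDirectedOrder I) (_ : Nonempty I) (x : I → E),
      Tendsto (fun i => canonicalJ (x i)) atTop (𝓝 z) := by
  have hex : ∀ w : RieszDual E, ∃ x : E, |z - canonicalJ x| |w| < 1 := fun w =>
    exists_canonicalJ_near hz (abs_nonneg w) one_pos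
  choose x hx using hex
  -- The order dual itself serves as directed index set: x w approximates z within 1 at |w|, hence
  -- within ε at u as soon as w ≥ ε⁻¹ • u.
  refine ⟨RieszDual E, inferInstance, inferInstance, ⟨0⟩, x, tendsto_iff_abs_sub.2 fun u hu => ?_⟩
  refine Metric.tendsto_nhds.2 fun ε hε => ?_
  filter_upwards [eventually_ge_atTop (ε⁻¹ • u)] with w hw
  rw [Real.dist_eq, sub_zero, _root_.abs_of_nonneg (apply_nonneg (abs_nonneg _) hu), abs_sub_comm]
  have h1 := mono_of_nonneg (abs_nonneg (z - canonicalJ (x w))) (hw.trans (le_abs_self w))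
  rw [map_smul] at h1
  have h2 := h1.trans_lt (hx w)
  rwa [inv_mul_lt_iff₀ hε, mul_one] at h2

end Density

end RieszDual

/-! ### Interchanging two order continuous functionals on a bilinear form. -/

namespace RieszDual

section Adjoint

variable {X Y : Type u} [AddCommGroup X] [Lattice X] [IsOrderedAddMonoid X] [Module ℝ X]
  [IsOrderedModule ℝ X] [AddCommGroup Y] [Lattice Y] [IsOrderedAddMonoid Y] [Module ℝ Y]
  [IsOrderedModule ℝ Y]

theorem mem_of_abs_le (f g : X →ₗ[ℝ] ℝ) (h : ∀ x, 0 ≤ x → |f x| ≤ g x) :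
    f ∈ orderBoundedFunctionals X := by
  have h1 : f + g ∈ orderBoundedFunctionals X := mem_of_nonneg _ fun x hx => by
    have := (abs_le.1 (h x hx)).1
    rw [LinearMap.add_apply]
    linarith
  have h2 : g ∈ orderBoundedFunctionals X := mem_of_nonneg _ fun x hx =>
    (abs_nonneg _).trans (h x hx)
  rw [← add_sub_cancel_right f g]
  exact Submodule.sub_mem _ h1 h2

/-- The adjoint `Y^~~ → X^~` of a positive operator `X → Y^~`, restricted to `X`. -/
noncomputable def adj (p : X →ₗ[ℝ] RieszDual Y) (hp : ∀ x, 0 ≤ x → 0 ≤ p x) :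
    RieszBidual Y →ₗ[ℝ] RieszDual X where
  toFun φ := mk
    { toFun := fun x => φ (p x)
      map_add' := fun x x' => by rw [_root_.map_add, map_add]
      map_smul' := fun c x => by rw [_root_.map_smul, map_smul]; rfl }
    (mem_of_abs_le _ (|φ|.1.comp p) fun x hx =>
      abs_apply_le (f := φ) (abs_of_nonneg (hp x hx)).le)
  map_add' _ _ := rfl
  map_smul' _ _ := rfl

theorem adj_apply (p : X →ₗ[ℝ] RieszDual Y) (hp : ∀ x, 0 ≤ x → 0 ≤ p x) (φ : RieszBidual Y)
    (x : X) : adj p hp φ x = φ (p x) := rfl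

theorem adj_nonneg (p : X →ₗ[ℝ] RieszDual Y) (hp : ∀ x, 0 ≤ x → 0 ≤ p x) {φ : RieszBidual Y}
    (hφ : 0 ≤ φ) : 0 ≤ adj p hp φ := fun x hx => hφ (p x) (hp x hx)

theorem abs_adj_le (p : X →ₗ[ℝ] RieszDual Y) (hp : ∀ x, 0 ≤ x → 0 ≤ p x) (φ : RieszBidual Y) :
    |adj p hp φ| ≤ adj p hp |φ| := by
  rw [abs_le']
  exact ⟨fun x hx => le_abs_self φ (p x) (hp x hx), fun x hx => neg_le_abs φ (p x) (hp x hx)⟩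

variable {p : X →ₗ[ℝ] RieszDual Y} {q : Y →ₗ[ℝ] RieszDual X} (hpq : ∀ x y, q y x = p x y)
  (hp : ∀ x, 0 ≤ x → 0 ≤ p x) (hq : ∀ y, 0 ≤ y → 0 ≤ q y)

include hpq in
-- The identity is immediate when φ = J y. In general approximate φ by J y at the functional p d +
-- adj q ψ: the bound ψ ≤ J d controls the error on the left by |φ - J y| (p d), and the error on
-- the right is at most |φ - J y| (adj q ψ).
theorem apply_adj_comm_of_le {φ : RieszBidual Y} (hφ : IsOrderContinuousFunctional φ)
    {ψ : RieszBidual X} (hψ0 : 0 ≤ ψ) {d : X} (hd : 0 ≤ d) (hψd : ψ ≤ canonicalJ d) :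
    ψ (adj p hp φ) = φ (adj q hq ψ) := by
  refine eq_of_abs_sub_le_all fun ε hε => ?_
  have hw₁ := hp d hd
  have hw₂ := adj_nonneg q hq hψ0
  obtain ⟨y, hy⟩ := exists_canonicalJ_near hφ (add_nonneg hw₁ hw₂) hε
  rw [map_add] at hy
  have h1 : ψ (adj p hp (canonicalJ y)) = canonicalJ y (adj q hq ψ) := by
    rw [canonicalJ_apply, adj_apply]
    congr 1
    exact DFunLike.ext _ _ fun x => (hpq x y).symm
  have h2 : ψ (adj p hp φ) - φ (adj q hq ψ) =
      ψ (adj p hp (φ - canonicalJ y)) - (φ - canonicalJ y) (adj q hq ψ) := by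
    rw [_root_.map_sub, map_sub, sub_apply, h1]
    ring
  have h3 := abs_apply_le (f := ψ) (abs_adj_le p hp (φ - canonicalJ y))
  rw [abs_of_nonneg hψ0] at h3
  have h4 := hψd _ (adj_nonneg p hp (abs_nonneg (φ - canonicalJ y)))
  rw [canonicalJ_apply, adj_apply] at h4
  have h5 := abs_apply_le (f := φ - canonicalJ y) (abs_of_nonneg hw₂).le
  rw [h2]
  refine (abs_sub_le_add _ _).trans ?_
  linarith

include hpq in
theorem apply_adj_comm_of_nonneg {φ : RieszBidual Y} (hφ : IsOrderContinuousFunctional φ)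
    (hφ0 : 0 ≤ φ) {ψ : RieszBidual X} (hψ : IsOrderContinuousFunctional ψ) (hψ0 : 0 ≤ ψ) :
    ψ (adj p hp φ) = φ (adj q hq ψ) := by
  have ht₁ := tendsto_posPart_sub_canonicalJ hψ hψ0 (adj_nonneg p hp hφ0)
  -- The images under adj q of the remainders (ψ - J d)⁺ decrease pointwise, hence in order, to 0,
  -- so order continuity of φ applies. With the remainders gone on both sides, the case ψ ⊓ J d ≤ J
  -- d suffices.
  have ht₂ : Tendsto (fun d : {d : X // 0 ≤ d} => φ (adj q hq (ψ - canonicalJ d.1)⁺)) atTop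
      (𝓝 0) := by
    refine hφ.tendsto (fun a b hab y hy => ?_) ⟨?_, fun l hl y hy => ?_⟩
    · exact posPart_mono (sub_le_sub_left (canonicalJ_mono (show a.1 ≤ b.1 from hab)) ψ) _ (hq y hy)
    · rintro _ ⟨d, rfl⟩
      exact adj_nonneg q hq (posPart_nonneg _)
    · exact ge_of_tendsto (tendsto_posPart_sub_canonicalJ hψ hψ0 (hq y hy))
        (Eventually.of_forall fun d => hl ⟨d, rfl⟩ y hy)
  have ht := ht₁.sub ht₂
  rw [sub_zero] at ht
  refine sub_eq_zero.1 (tendsto_nhds_unique (tendsto_const_nhds.congr fun d => ?_) ht)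
  have h1 : ψ - (ψ - canonicalJ d.1)⁺ = ψ ⊓ canonicalJ d.1 := by
    have : (ψ - canonicalJ d.1)⁺ = ψ - ψ ⊓ canonicalJ d.1 := by
      rw [sub_inf, sub_self, sup_comm]
      rfl
    rw [this, sub_sub_cancel]
  have h2 := apply_adj_comm_of_le hpq hp hq hφ (le_inf hψ0 (canonicalJ_nonneg d.2)) d.2
    (inf_le_right : ψ ⊓ canonicalJ d.1 ≤ _)
  rw [← h1, _root_.map_sub, map_sub, sub_apply] at h2
  linarith

include hpq in
theorem apply_adj_comm {φ : RieszBidual Y} (hφ : IsOrderContinuousFunctional φ)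
    {ψ : RieszBidual X} (hψ : IsOrderContinuousFunctional ψ) :
    ψ (adj p hp φ) = φ (adj q hq ψ) := by
  have h := fun (φ' : RieszBidual Y) hφ hφ0 (ψ' : RieszBidual X) hψ hψ0 =>
    apply_adj_comm_of_nonneg hpq hp hq (φ := φ') hφ hφ0 (ψ := ψ') hψ hψ0
  have h1 := h _ hφ.posPart (posPart_nonneg φ) _ hψ.posPart (posPart_nonneg ψ)
  have h2 := h _ hφ.posPart (posPart_nonneg φ) _ hψ.negPart (negPart_nonneg ψ)
  have h3 := h _ hφ.negPart (negPart_nonneg φ) _ hψ.posPart (posPart_nonneg ψ)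
  have h4 := h _ hφ.negPart (negPart_nonneg φ) _ hψ.negPart (negPart_nonneg ψ)
  rw [← posPart_sub_negPart φ, ← posPart_sub_negPart ψ]
  simp only [_root_.map_sub, map_sub, sub_apply]
  linarith

end Adjoint

section Dominated

variable {X Y : Type u} [AddCommGroup X] [Lattice X] [IsOrderedAddMonoid X] [Module ℝ X]
  [IsOrderedModule ℝ X] [AddCommGroup Y] [Lattice Y] [IsOrderedAddMonoid Y] [Module ℝ Y]
  [IsOrderedModule ℝ Y]

/-- Order continuous functionals commute on a bilinear form `(x, y) ↦ p x y` dominated by a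
positive one. -/
theorem apply_comm_of_abs_le (p P : X →ₗ[ℝ] RieszDual Y) (h : ∀ x, 0 ≤ x → |p x| ≤ P x)
    {φ : RieszBidual Y} (hφ : IsOrderContinuousFunctional φ) {ψ : RieszBidual X}
    (hψ : IsOrderContinuousFunctional ψ) {a : RieszDual X} (ha : ∀ x, a x = φ (p x))
    {q : Y → RieszDual X} (hq : ∀ y x, q y x = p x y) {b : RieszDual Y}
    (hb : ∀ y, b y = ψ (q y)) : ψ a = φ b := by
  have hP : ∀ x, 0 ≤ x → 0 ≤ P x := fun x hx => (abs_nonneg _).trans (h x hx)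
  -- Writing p = (P + p) - P reduces the claim to two positive operators; `tr` below is the
  -- transpose of such an operator.
  have hPp : ∀ x, 0 ≤ x → 0 ≤ (P + p) x := fun x hx => by
    rw [LinearMap.add_apply, ← sub_neg_eq_add, sub_nonneg]
    exact (neg_le_abs _).trans (h x hx)
  let tr : ∀ r : X →ₗ[ℝ] RieszDual Y, (∀ x, 0 ≤ x → 0 ≤ r x) → Y →ₗ[ℝ] RieszDual X :=
    fun r hr =>
      { toFun := fun y => adj r hr (canonicalJ y)
        map_add' := fun y y' => by rw [canonicalJ_add, _root_.map_add]
        map_smul' := fun c y => DFunLike.ext _ _ fun x => map_smul (r x) c y }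
  have htr : ∀ r hr x y, tr r hr y x = r x y := fun _ _ _ _ => rfl
  have htr0 : ∀ r hr y, 0 ≤ y → 0 ≤ tr r hr y := fun r hr y hy =>
    adj_nonneg r hr (canonicalJ_nonneg hy)
  have h1 := apply_adj_comm (htr _ hPp) hPp (htr0 _ hPp) hφ hψ
  have h2 := apply_adj_comm (htr _ hP) hP (htr0 _ hP) hφ hψ
  have ha' : a = adj (P + p) hPp φ - adj P hP φ := DFunLike.ext _ _ fun x => by
    rw [sub_apply, adj_apply, adj_apply, ha, LinearMap.add_apply, map_add]
    ring
  have hb' : b = adj (tr _ hPp) (htr0 _ hPp) ψ - adj (tr _ hP) (htr0 _ hP) ψ :=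
    DFunLike.ext _ _ fun y => by
      have : q y = tr _ hPp y - tr _ hP y := DFunLike.ext _ _ fun x => by
        rw [sub_apply, htr, htr, hq, LinearMap.add_apply, add_apply]
        ring
      rw [sub_apply, adj_apply, adj_apply, hb, this, map_sub]
  rw [ha', hb', map_sub, map_sub, h1, h2]

end Dominated

end RieszDual

/-! ### Iterations as functions of a single variable. -/

namespace Arens

section Slots

theorem update_comp_apply {ι κ : Type*} [DecidableEq ι] [DecidableEq κ] {G : κ → Type*}
    (ρ : ι → κ) (hρ : Function.Injective ρ) (x : ∀ k, G k) (j : ι) (z : G (ρ j)) :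
    (fun i => Function.update x (ρ j) z (ρ i)) = Function.update (fun i => x (ρ i)) j z :=
  Function.update_comp_eq_of_injective' x hρ j z

theorem isOrderContinuous_update {ι : Type*} [DecidableEq ι] {E : ι → Type u}
    [∀ i, AddCommGroup (E i)] [∀ i, Lattice (E i)] [∀ i, IsOrderedAddMonoid (E i)]
    [∀ i, Module ℝ (E i)] [∀ i, IsOrderedModule ℝ (E i)] {x'' : ∀ i, RieszBidual (E i)}
    (hx : ∀ i, IsOrderContinuousFunctional (x'' i)) (j : ι) {z : RieszBidual (E j)}
    (hz : IsOrderContinuousFunctional z) (i : ι) :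
    IsOrderContinuousFunctional (Function.update x'' j z i) := by
  rcases eq_or_ne i j with rfl | hij
  · rwa [Function.update_self]
  · rw [Function.update_of_ne hij]
    exact hx i

/-- An order continuous functional commutes with the iteration of order continuous functionals on a
linear family of regular forms. -/
theorem iterate_comm : ∀ {n : ℕ} {E : Fin n → Type u} [∀ i, AddCommGroup (E i)]
    [∀ i, Lattice (E i)] [∀ i, IsOrderedAddMonoid (E i)] [∀ i, Module ℝ (E i)]
    [∀ i, IsOrderedModule ℝ (E i)] {X : Type u} [AddCommGroup X] [Lattice X]
    [IsOrderedAddMonoid X] [Module ℝ X] [IsOrderedModule ℝ X]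
    {x'' : ∀ i, RieszBidual (E i)}, (∀ i, IsOrderContinuousFunctional (x'' i)) →
    ∀ {z : RieszBidual X}, IsOrderContinuousFunctional z →
    ∀ (T D : X →ₗ[ℝ] RegularForm E), (∀ e, 0 ≤ e → Dom (D e).1 (T e).1) →
    ∀ {C : RegularForm E},
      (∀ t (a : RieszDual X), (∀ e, a e = (T e).1 t) → C.1 t = z a) →
    ∀ {w : RieszDual X}, (∀ e, w e = iterate x'' (T e)) → iterate x'' C = z w := by
  intro n
  induction n with
  | zero =>
    intro E _ _ _ _ _ X _ _ _ _ _ x'' _ z _ T D _ C hC w hw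
    exact hC _ w hw
  | succ n ih =>
    intro E _ _ _ _ _ X _ _ _ _ _ x'' hx z hz T D hTD C hC w hw
    -- After applying x'' 0 to both the family and C, the induction hypothesis requires only that z
    -- and x'' 0 commute on the bilinear form (e, s) ↦ T e (s, t), with t fixed. As t need not be
    -- positive, the dominating bilinear form is taken at |t|.
    refine ih (x'' := fun i => x'' i.succ) (fun i => hx i.succ) hz ((step (x'' 0)).comp T)
      ((step |x'' 0|).comp D) (fun e he => stepForm_dom (x'' 0) (hTD e he)) (fun t a ha => ?_) hw
    have hdom : ∀ e, 0 ≤ e → ∀ (s : E 0) t, |(T e).1 (Fin.cons s t)| ≤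
        (D e).1 (Fin.cons |s| fun i => |t i|) := fun e he s t => by
      refine (hTD e he).abs_le fun i => ?_
      refine Fin.cases ?_ (fun j => ?_) i <;> simp
    let p : X →ₗ[ℝ] RieszDual (E 0) :=
      { toFun := fun e => assoc (T e) t
        map_add' := fun e e' => by rw [map_add]; rfl
        map_smul' := fun c e => by rw [map_smul]; rfl }
    let P : X →ₗ[ℝ] RieszDual (E 0) :=
      { toFun := fun e => assoc (D e) fun i => |t i|
        map_add' := fun e e' => by rw [map_add]; rfl
        map_smul' := fun c e => by rw [map_smul]; rfl }
    have hpP : ∀ e, 0 ≤ e → |p e| ≤ P e := fun e he => by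
      rw [abs_le']
      constructor
      · intro s hs
        have := hdom e he s t
        rw [abs_of_nonneg hs] at this
        exact (le_abs_self _).trans this
      · intro s hs
        have := hdom e he s t
        rw [abs_of_nonneg hs] at this
        exact (neg_le_abs _).trans this
    let q : E 0 → RieszDual X := fun s => RieszDual.mk
      { toFun := fun e => (T e).1 (Fin.cons s t)
        map_add' := fun e e' => by rw [map_add]; rfl
        map_smul' := fun c e => by rw [map_smul]; rfl }
      (RieszDual.mem_of_abs_le _
        { toFun := fun e => (D e).1 (Fin.cons |s| fun i => |t i|)
          map_add' := fun e e' => by rw [map_add]; rfl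
          map_smul' := fun c e => by rw [map_smul]; rfl }
        fun e he => hdom e he s t)
    exact (RieszDual.apply_comm_of_abs_le p P hpP (hx 0) hz (a := a) ha (q := q)
      (fun _ _ => rfl) (b := assoc C t) fun s => hC _ (q s) fun _ => rfl).symm

variable {n : ℕ}

/-- The form `B(e, •)` as a linear function of `e`. -/
noncomputable def curryForm {E : Fin (n + 1) → Type u} [∀ i, AddCommGroup (E i)]
    [∀ i, Lattice (E i)] [∀ i, IsOrderedAddMonoid (E i)] [∀ i, Module ℝ (E i)]
    [∀ i, IsOrderedModule ℝ (E i)] (B : RegularForm E) :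
    E 0 →ₗ[ℝ] RegularForm fun i : Fin n => E i.succ where
  toFun e := ⟨B.1.curryLeft e, by
    obtain ⟨D, hD⟩ := exists_dom B.2
    refine Dom.isRegular (D := D.curryLeft |e|) fun t ht => hD.abs_le fun i => ?_
    refine Fin.cases ?_ (fun j => ?_) i
    · simp
    · simpa using (abs_of_nonneg (ht j)).le⟩
  map_add' e e' := Subtype.ext (B.1.curryLeft.map_add e e')
  map_smul' c e := Subtype.ext (B.1.curryLeft.map_smul c e)

theorem curryForm_dom {E : Fin (n + 1) → Type u} [∀ i, AddCommGroup (E i)]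
    [∀ i, Lattice (E i)] [∀ i, IsOrderedAddMonoid (E i)] [∀ i, Module ℝ (E i)]
    [∀ i, IsOrderedModule ℝ (E i)] {D B : RegularForm E} (h : Dom D.1 B.1) {e : E 0}
    (he : 0 ≤ e) : Dom (curryForm D e).1 (curryForm B e).1 := fun t ht => by
  refine h _ fun i => ?_
  refine Fin.cases ?_ (fun j => ?_) i
  · simpa using he
  · simpa using ht j

theorem iterate_update_zero {E : Fin (n + 1) → Type u} [∀ i, AddCommGroup (E i)]
    [∀ i, Lattice (E i)] [∀ i, IsOrderedAddMonoid (E i)] [∀ i, Module ℝ (E i)]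
    [∀ i, IsOrderedModule ℝ (E i)] (x'' : ∀ i, RieszBidual (E i)) (z : RieszBidual (E 0))
    (B : RegularForm E) :
    iterate (Function.update x'' 0 z) B = iterate (fun i => x'' i.succ) (step z B) := by
  change iterate (fun i : Fin n => Function.update x'' 0 z i.succ)
    (step (Function.update x'' 0 z 0) B) = _
  have : (fun i : Fin n => Function.update x'' 0 z i.succ) = fun i : Fin n => x'' i.succ :=
    funext fun i => Function.update_of_ne (Fin.succ_ne_zero i) _ _
  rw [this, Function.update_self]

theorem step_sub {E : Fin (n + 1) → Type u} [∀ i, AddCommGroup (E i)]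
    [∀ i, Lattice (E i)] [∀ i, IsOrderedAddMonoid (E i)] [∀ i, Module ℝ (E i)]
    [∀ i, IsOrderedModule ℝ (E i)] (z z' : RieszBidual (E 0)) (B : RegularForm E) :
    step (z - z') B = step z B - step z' B := by
  refine Subtype.ext (MultilinearMap.ext fun t => ?_)
  change (z - z') (assoc B t) = z (assoc B t) - z' (assoc B t)
  rw [RieszDual.sub_apply]

/-- As a function of each single order continuous variable, the iteration is the evaluation at an
element of the order dual. -/
theorem exists_iterate_update_eq : ∀ {n : ℕ} {E : Fin n → Type u} [∀ i, AddCommGroup (E i)]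
    [∀ i, Lattice (E i)] [∀ i, IsOrderedAddMonoid (E i)] [∀ i, Module ℝ (E i)]
    [∀ i, IsOrderedModule ℝ (E i)] {x'' : ∀ i, RieszBidual (E i)},
    (∀ i, IsOrderContinuousFunctional (x'' i)) → ∀ (B : RegularForm E) (j : Fin n),
    ∃ w : RieszDual (E j), ∀ z : RieszBidual (E j), IsOrderContinuousFunctional z →
      iterate (Function.update x'' j z) B = z w := by
  intro n
  induction n with
  | zero => intro E _ _ _ _ _ x'' _ B j; exact j.elim0
  | succ n ih =>
    intro E _ _ _ _ _ x'' hx B j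
    refine Fin.cases ?_ (fun j => ?_) j
    · obtain ⟨D, hD⟩ := exists_dom B.2
      let D' : RegularForm E :=
        ⟨D, Dom.isRegular (D := D) fun x hx => (abs_of_nonneg (hD.isPositive x hx)).le⟩
      -- The functional w sends e to the iteration of the remaining x'' i on B(e, •). That z may be
      -- applied last instead of first is exactly `iterate_comm`.
      refine ⟨RieszDual.mk ((iterate fun i => x'' i.succ).comp (curryForm B))
        (RieszDual.mem_of_abs_le _ ((iterate fun i => |x'' i.succ|).comp (curryForm D'))
          fun e he => iterate_dom _ (curryForm_dom (D := D') hD he)), fun z hz => ?_⟩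
      rw [iterate_update_zero]
      refine iterate_comm (fun i => hx i.succ) hz (curryForm B) (curryForm D')
        (fun e he => curryForm_dom (D := D') hD he) (fun t a ha => ?_) fun _ => rfl
      rw [step_apply]
      congr 1
      exact DFunLike.ext _ _ fun e => (ha e).symm
    · obtain ⟨w, hw⟩ := ih (x'' := fun i => x'' i.succ) (fun i => hx i.succ) (step (x'' 0) B) j
      refine ⟨w, fun z hz => ?_⟩
      rw [← hw z hz]
      change iterate (fun i : Fin n => Function.update x'' j.succ z i.succ)
        (step (Function.update x'' j.succ z 0) B) = _
      rw [Function.update_of_ne (Fin.succ_ne_zero j).symm,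
        update_comp_apply Fin.succ (Fin.succ_injective n)]

theorem iterate_canonicalJ : ∀ {n : ℕ} {E : Fin n → Type u} [∀ i, AddCommGroup (E i)]
    [∀ i, Lattice (E i)] [∀ i, IsOrderedAddMonoid (E i)] [∀ i, Module ℝ (E i)]
    [∀ i, IsOrderedModule ℝ (E i)] (x : ∀ i, E i) (B : RegularForm E),
    iterate (fun i => canonicalJ (x i)) B = B.1 x := by
  intro n
  induction n with
  | zero =>
    intro E _ _ _ _ _ x B
    exact congrArg B.1 (Subsingleton.elim _ _)
  | succ n ih =>
    intro E _ _ _ _ _ x B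
    refine (ih (fun i => x i.succ) (curryForm B (x 0))).trans ?_
    exact congrArg B.1 (Fin.cons_self_tail x)

end Slots

/-! ### Independence of the permutation. -/

section Permutation

variable {m : ℕ} {E : Fin m → Type u} {F : Type v} [∀ i, AddCommGroup (E i)] [∀ i, Lattice (E i)]
  [∀ i, IsOrderedAddMonoid (E i)] [∀ i, Module ℝ (E i)] [∀ i, IsOrderedModule ℝ (E i)]
  [AddCommGroup F] [Lattice F] [IsOrderedAddMonoid F] [Module ℝ F] [IsOrderedModule ℝ F]

theorem unorder_comp {X : Fin m → Type w} (ρ : Equiv.Perm (Fin m)) (x : ∀ k, X k) :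
    unorder ρ (fun j => x (ρ j)) = x := by
  funext k
  obtain ⟨j, rfl⟩ := ρ.surjective k
  rw [unorder_apply]

theorem extension_apply (ρ : Equiv.Perm (Fin m)) (A : MultilinearMap ℝ E F)
    (hA : IsRegularMultilinear A) (x'' : ∀ k, RieszBidual (E k)) (y' : RieszDual F) :
    extension ρ A hA x'' y' =
      iterate (fun j => x'' (ρ j)) ⟨composedForm ρ A y', composedForm_regular ρ hA y'⟩ := rfl

theorem exists_extension_update_eq (ρ : Equiv.Perm (Fin m)) (A : MultilinearMap ℝ E F)
    (hA : IsRegularMultilinear A) {x'' : ∀ k, RieszBidual (E k)}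
    (hx : ∀ k, IsOrderContinuousFunctional (x'' k)) (y' : RieszDual F) (k : Fin m) :
    ∃ w : RieszDual (E k), ∀ z : RieszBidual (E k), IsOrderContinuousFunctional z →
      extension ρ A hA (Function.update x'' k z) y' = z w := by
  obtain ⟨j, rfl⟩ := ρ.surjective k
  obtain ⟨w, hw⟩ := exists_iterate_update_eq (fun j => hx (ρ j))
    ⟨composedForm ρ A y', composedForm_regular ρ hA y'⟩ j
  refine ⟨w, fun z hz => ?_⟩
  rw [← hw z hz, extension_apply, update_comp_apply ρ ρ.injective]

theorem extension_canonicalJ (ρ : Equiv.Perm (Fin m)) (A : MultilinearMap ℝ E F)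
    (hA : IsRegularMultilinear A) (x : ∀ k, E k) (y' : RieszDual F) :
    extension ρ A hA (fun k => canonicalJ (x k)) y' = y' (A x) := by
  rw [extension_apply, iterate_canonicalJ (fun j => x (ρ j)), composedForm_apply, unorder_comp]

/-- On order continuous functionals the Arens extension does not depend on the permutation. -/
theorem extension_eq_extension (ρ σ : Equiv.Perm (Fin m)) (A : MultilinearMap ℝ E F)
    (hA : IsRegularMultilinear A) {x'' : ∀ k, RieszBidual (E k)}
    (hx : ∀ k, IsOrderContinuousFunctional (x'' k)) :
    extension ρ A hA x'' = extension σ A hA x'' := by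
  refine DFunLike.ext _ _ fun y' => ?_
  -- Induction on a set S outside which all arguments lie in J(E). In coordinate k both extensions
  -- are evaluations, at w and w'. Testing with J x removes k from S, so the induction hypothesis
  -- gives w = w'.
  have key : ∀ (S : Finset (Fin m)) (x'' : ∀ k, RieszBidual (E k)),
      (∀ k, IsOrderContinuousFunctional (x'' k)) → (∀ k ∉ S, ∃ x, x'' k = canonicalJ x) →
      extension ρ A hA x'' y' = extension σ A hA x'' y' := by
    intro S
    induction S using Finset.induction_on with
    | empty =>
      intro x'' _ h
      choose x h using fun k => h k (Finset.notMem_empty k)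
      obtain rfl := funext h
      rw [extension_canonicalJ, extension_canonicalJ]
    | insert k S _ ih =>
      intro x'' hx h
      obtain ⟨w, hw⟩ := exists_extension_update_eq ρ A hA hx y' k
      obtain ⟨w', hw'⟩ := exists_extension_update_eq σ A hA hx y' k
      have hww : w = w' := DFunLike.ext _ _ fun x => by
        have hJ := RieszDual.isOrderContinuous_canonicalJ x
        rw [← canonicalJ_apply x w, ← canonicalJ_apply x w', ← hw _ hJ, ← hw' _ hJ]
        refine ih _ (isOrderContinuous_update hx k hJ) fun l hl => ?_
        rcases eq_or_ne l k with rfl | hlk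
        · exact ⟨x, Function.update_self _ _ _⟩
        · rw [Function.update_of_ne hlk]
          exact h l (by simp [hlk, hl])
      have h1 := hw _ (hx k)
      have h2 := hw' _ (hx k)
      rw [Function.update_eq_self] at h1 h2
      rw [h1, h2, hww]
  exact key Finset.univ x'' hx fun k hk => absurd (Finset.mem_univ k) hk

end Permutation

/-! ### Iterated limit formulas. -/

section IteratedLimit

variable {F : Type v} [AddCommGroup F] [Lattice F] [IsOrderedAddMonoid F] [Module ℝ F]
  [IsOrderedModule ℝ F]

theorem isRegularMultilinear_curryLeft {n : ℕ} {E : Fin (n + 1) → Type u}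
    [∀ i, AddCommGroup (E i)] [∀ i, Lattice (E i)] [∀ i, IsOrderedAddMonoid (E i)]
    [∀ i, Module ℝ (E i)] {A : MultilinearMap ℝ E F} (hA : IsRegularMultilinear A) (e : E 0) :
    IsRegularMultilinear (A.curryLeft e) := by
  obtain ⟨A₁, A₂, h₁, h₂, rfl⟩ := hA
  have hpos : ∀ A : MultilinearMap ℝ E F, IsPositiveMultilinear A → ∀ e, 0 ≤ e → ∀ t : ∀ i : Fin n,
      E i.succ, (∀ i, 0 ≤ t i) → 0 ≤ A.curryLeft e t := fun A h e he t ht => by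
    refine h _ fun i => ?_
    refine Fin.cases ?_ (fun j => ?_) i
    · simpa using he
    · simpa using ht j
  refine ⟨A₁.curryLeft e⁺ + A₂.curryLeft e⁻, A₁.curryLeft e⁻ + A₂.curryLeft e⁺,
    fun t ht => add_nonneg (hpos _ h₁ _ (posPart_nonneg e) t ht)
      (hpos _ h₂ _ (negPart_nonneg e) t ht),
    fun t ht => add_nonneg (hpos _ h₁ _ (negPart_nonneg e) t ht)
      (hpos _ h₂ _ (posPart_nonneg e) t ht), ?_⟩
  have h : (A₁ - A₂).curryLeft e = A₁.curryLeft e - A₂.curryLeft e := rfl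
  rw [h]
  nth_rewrite 1 2 [← posPart_sub_negPart e]
  rw [map_sub, map_sub]
  abel

/-- The operator `A` with its variables listed in the order `ρ 0, ρ 1, …, ρ (m - 1)`. -/
def reorder {m : ℕ} {E : Fin m → Type u} [∀ i, AddCommGroup (E i)] [∀ i, Module ℝ (E i)]
    (ρ : Equiv.Perm (Fin m)) (A : MultilinearMap ℝ E F) :
    MultilinearMap ℝ (fun j => E (ρ j)) F :=
  MultilinearMap.mk' (fun t => A (unorder ρ t))
    (fun t j a b => by simp only [unorder_update ρ t j, A.map_update_add])
    (fun t j c a => by simp only [unorder_update ρ t j, A.map_update_smul])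

theorem isRegularMultilinear_reorder {m : ℕ} {E : Fin m → Type u} [∀ i, AddCommGroup (E i)]
    [∀ i, Lattice (E i)] [∀ i, Module ℝ (E i)] (ρ : Equiv.Perm (Fin m))
    {A : MultilinearMap ℝ E F} (hA : IsRegularMultilinear A) :
    IsRegularMultilinear (reorder ρ A) := by
  obtain ⟨A₁, A₂, h₁, h₂, rfl⟩ := hA
  exact ⟨reorder ρ A₁, reorder ρ A₂,
    fun t ht => h₁ _ (unorder_prop ρ (p := fun k x => (0 : E k) ≤ x) ht),
    fun t ht => h₂ _ (unorder_prop ρ (p := fun k x => (0 : E k) ≤ x) ht), rfl⟩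

theorem composedForm_one_apply {m : ℕ} {E : Fin m → Type u} [∀ i, AddCommGroup (E i)]
    [∀ i, Lattice (E i)] [∀ i, Module ℝ (E i)] (A : MultilinearMap ℝ E F) (y' : RieszDual F)
    (t : ∀ i, E i) : composedForm 1 A y' t = y' (A t) :=
  congrArg (fun t => y' (A t)) (unorder_comp 1 t)

/-- The iterated limit formula in which the limit over the first variable is taken last. -/
theorem isIteratedLimit_of_apply_eq : ∀ {n : ℕ} {E : Fin n → Type u} [∀ i, AddCommGroup (E i)]
    [∀ i, Lattice (E i)] [∀ i, IsOrderedAddMonoid (E i)] [∀ i, Module ℝ (E i)]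
    [∀ i, IsOrderedModule ℝ (E i)] {A : MultilinearMap ℝ E F}, IsRegularMultilinear A →
    ∀ {x'' : ∀ i, RieszBidual (E i)}, (∀ i, IsOrderContinuousFunctional (x'' i)) →
    ∀ {I : Fin n → Type w} [∀ i, Preorder (I i)] (x : ∀ i, I i → E i),
    (∀ i, Tendsto (fun a => canonicalJ (x i a)) atTop (𝓝 (x'' i))) →
    ∀ {L : RieszBidual F},
      (∀ (y' : RieszDual F) (B : RegularForm E), (∀ t, B.1 t = y' (A t)) → L y' = iterate x'' B) →
      IsIteratedLimit (I := I) (fun a => canonicalJ (A fun i => x i (a i))) L := by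
  intro n
  induction n with
  | zero =>
    intro E _ _ _ _ _ A hA x'' _ I _ x _ L hL
    refine DFunLike.ext _ _ fun y' => ?_
    rw [canonicalJ_apply, hL y' ⟨composedForm 1 A y', composedForm_regular 1 hA y'⟩
      (composedForm_one_apply A y')]
    change _ = composedForm 1 A y' _
    rw [composedForm_one_apply]
    congr 2
    exact Subsingleton.elim _ _
  | succ n ih =>
    intro E _ _ _ _ _ A hA x'' hx'' I _ x hx L hL
    have hcurry := isRegularMultilinear_curryLeft hA
    have hv : ∀ (a : I 0) (y' : RieszDual F) (B : RegularForm fun i : Fin n => E i.succ),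
        (∀ t, B.1 t = y' (A.curryLeft (x 0 a) t)) →
        extension 1 (A.curryLeft (x 0 a)) (hcurry (x 0 a)) (fun i => x'' i.succ) y' =
          iterate (fun i => x'' i.succ) B := fun a y' B hB => by
      rw [extension_apply]
      congr 1
      exact Subtype.ext (MultilinearMap.ext fun t => (composedForm_one_apply _ y' t).trans (hB t).symm)
    -- The inner limit at a is the extension of A(x 0 a, •) at the remaining arguments.
    refine ⟨fun a => extension 1 (A.curryLeft (x 0 a)) (hcurry (x 0 a)) fun i => x'' i.succ,
      fun a => ?_, ?_⟩
    · have h := ih (hcurry (x 0 a)) (fun i => hx'' i.succ) (I := fun i => I i.succ)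
        (fun i => x i.succ) (fun i => hx i.succ) (hv a)
      convert h using 3 with t
      change _ = A (Fin.cons (x 0 a) fun i => x i.succ (t i))
      congr 1
      funext i
      refine Fin.cases ?_ (fun j => ?_) i <;> simp
    · obtain ⟨A₁, A₂, h₁, h₂, rfl⟩ := id hA
      have hD : IsRegularMultilinear (A₁ + A₂) :=
        ⟨A₁ + A₂, 0, fun x hx => add_nonneg (h₁ x hx) (h₂ x hx), fun x _ => le_rfl, by simp⟩
      refine RieszDual.tendsto_iff_abs_sub.2 fun U hU => ?_
      have hDU : IsRegularMultilinear (composedForm 1 (A₁ + A₂) U) := composedForm_regular 1 hD U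
      -- This w comes from the positive form U ∘ (A₁ + A₂) and the |x'' i|, so it depends neither on
      -- a nor on the functionals y' with |y'| ≤ U. It bounds the outer error at U by |J (x 0 a) -
      -- x'' 0| (|w|).
      obtain ⟨w, hw⟩ := exists_iterate_update_eq (fun i => (hx'' i).abs)
        (⟨composedForm 1 (A₁ + A₂) U, hDU⟩ : RegularForm E) 0
      refine squeeze_zero (fun a => RieszDual.apply_nonneg (abs_nonneg _) hU) (fun a => ?_)
        (RieszDual.tendsto_iff_abs_sub.1 (hx 0) |w| (abs_nonneg w))
      have hδ := (RieszDual.isOrderContinuous_canonicalJ (x 0 a)).sub (hx'' 0)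
      refine RieszDual.abs_apply_le_of_forall _ hU fun y' hy' => ?_
      let B : RegularForm E := ⟨composedForm 1 (A₁ - A₂) y', composedForm_regular 1 hA y'⟩
      have hB : ∀ t, B.1 t = y' ((A₁ - A₂) t) := composedForm_one_apply _ y'
      -- Both terms are iterations of the same form B, with J (x 0 a) and x'' 0 in the first slot
      -- respectively; linearity in that slot combines them.
      have h1 : (extension 1 ((A₁ - A₂).curryLeft (x 0 a)) (hcurry (x 0 a))
          (fun i => x'' i.succ) - L) y' =
          iterate (Function.update x'' 0 (canonicalJ (x 0 a) - x'' 0)) B := by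
        rw [RieszDual.sub_apply, hL y' B hB, hv a y' (curryForm B (x 0 a)) fun t => hB _,
          iterate_update_zero, step_sub]
        exact (map_sub (iterate fun i : Fin n => x'' i.succ) _ _).symm
      have h2 : (fun i => |Function.update x'' 0 (canonicalJ (x 0 a) - x'' 0) i|) =
          Function.update (fun i => |x'' i|) 0 |canonicalJ (x 0 a) - x'' 0| := by
        funext i
        rcases eq_or_ne i 0 with rfl | hi
        · rw [Function.update_self, Function.update_self]
        · rw [Function.update_of_ne hi, Function.update_of_ne hi]
      have h3 := iterate_dom (Function.update x'' 0 (canonicalJ (x 0 a) - x'' 0))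
        (D := ⟨composedForm 1 (A₁ + A₂) U, hDU⟩) (B := B) (composedForm_dom 1 h₁ h₂ hy')
      rw [h2, hw _ hδ.abs] at h3
      rw [h1]
      exact ((le_abs_self _).trans h3).trans
        (RieszDual.mono_of_nonneg (abs_nonneg _) (le_abs_self w))

theorem isIteratedLimit_extension {m : ℕ} {E : Fin m → Type u} [∀ i, AddCommGroup (E i)]
    [∀ i, Lattice (E i)] [∀ i, IsOrderedAddMonoid (E i)] [∀ i, Module ℝ (E i)]
    [∀ i, IsOrderedModule ℝ (E i)] (ρ : Equiv.Perm (Fin m)) {A : MultilinearMap ℝ E F}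
    (hA : IsRegularMultilinear A) {x'' : ∀ i, RieszBidual (E i)}
    (hx'' : ∀ i, IsOrderContinuousFunctional (x'' i)) {I : Fin m → Type w} [∀ i, Preorder (I i)]
    (x : ∀ i, I i → E i) (hx : ∀ i, Tendsto (fun a => canonicalJ (x i a)) atTop (𝓝 (x'' i))) :
    IsIteratedLimit (I := fun j => I (ρ j)) (fun a => canonicalJ (A fun k => x k (unorder ρ a k)))
      (extension ρ A hA x'') := by
  have h := isIteratedLimit_of_apply_eq (isRegularMultilinear_reorder ρ hA)
    (fun j => hx'' (ρ j)) (I := fun j => I (ρ j)) (fun j => x (ρ j)) (fun j => hx (ρ j))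
    (L := extension ρ A hA x'') fun y' B hB => by
      rw [extension_apply]
      congr 1
      exact Subtype.ext (MultilinearMap.ext fun t => (hB t).symm)
  convert h using 3 with a
  change _ = A (unorder ρ fun j => x (ρ j) (a j))
  congr 1
  funext k
  obtain ⟨j, rfl⟩ := ρ.surjective k
  rw [unorder_apply, unorder_apply]

end IteratedLimit

end Arens

theorem proposition2p5 {m : ℕ} {E : Fin m → Type u} {F : Type v}
    [∀ k, AddCommGroup (E k)] [∀ k, Lattice (E k)] [∀ k, IsOrderedAddMonoid (E k)]
    [∀ k, Module ℝ (E k)] [∀ k, IsOrderedModule ℝ (E k)]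
    [AddCommGroup F] [Lattice F] [IsOrderedAddMonoid F] [Module ℝ F] [IsOrderedModule ℝ F]
    (hE : ∀ k, IsArchimedeanRiesz (E k))
    (ρ : Equiv.Perm (Fin m)) (A : MultilinearMap ℝ E F) (hA : IsRegularMultilinear A)
    (x'' : ∀ k, RieszBidual (E k)) (hx'' : ∀ k, IsOrderContinuousFunctional (x'' k)) :
    (∀ k, ∃ (I : Type u) (_ : Preorder I) (_ : IsDirectedOrder I) (_ : Nonempty I) (x : I → E k),
      Tendsto (fun i => canonicalJ (x i)) atTop (𝓝 (x'' k))) ∧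
    ∀ (I : Fin m → Type w) [∀ k, Preorder (I k)] [∀ k, IsDirectedOrder (I k)]
      [∀ k, Nonempty (I k)] (x : ∀ k, I k → E k),
      (∀ k, Tendsto (fun i => canonicalJ (x k i)) atTop (𝓝 (x'' k))) →
        Arens.IsIteratedLimit (I := fun j => I (ρ j))
          (fun a => canonicalJ (A fun k => x k (Arens.unorder ρ a k)))
          (Arens.extension ρ A hA x'') ∧
        Arens.IsIteratedLimit (I := fun j => I ((Fin.revPerm.trans ρ) j))
          (fun a => canonicalJ (A fun k => x k (Arens.unorder (Fin.revPerm.trans ρ) a k)))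
          (Arens.extension ρ A hA x'') := by
  refine ⟨fun k => RieszDual.exists_net_tendsto (hx'' k), fun I _ _ _ x hx => ⟨?_, ?_⟩⟩
  · exact Arens.isIteratedLimit_extension ρ hA hx'' x hx
  -- Reversing the order of the limits means listing the variables by the reversed permutation,
  -- whose extension is the same.
  · rw [Arens.extension_eq_extension ρ (Fin.revPerm.trans ρ) A hA hx'']
    exact Arens.isIteratedLimit_extension (Fin.revPerm.trans ρ) hA hx'' x hx
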